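/- **Setting.** Let $\Omega$ be a finite set of states and let $f_1,\dots,f_m\subseteq\Omega$ be flaws, at least one of them non-empty, ordered by priority according to a fixed permutation. A state is *flawed* if it lies in some $f_i$; for a flawed state $\sigma$ let $\pi(\sigma)$ be the highest-priority flaw containing $\sigma$. For every $\sigma$ let $\rho_{\mathrm{pr}}(\sigma,\cdot)$ be a probability distribution on $\Omega$, with $\rho_{\mathrm{pr}}(\sigma,\sigma)=1$ if $\sigma$ is flawless, and let $D_{\mathrm{pr}}$ be the digraph with arcs $(\sigma,\tau)$ such that $\rho_{\mathrm{pr}}(\sigma,\tau)>0$. Let $D_{\mathrm{ns}}$ be an arbitrary digraph on $\Omega$ and, for every $\sigma$, $\rho_{\mathrm{ns}}(\sigma,\cdot)$ an arbitrary probability distribution on the arcs of $D_{\mathrm{ns}}$ leaving $\sigma$. For $p\in[0,1]$ let $\rho=(1-p)\rho_{\mathrm{pr}}+p\,\rho_{\mathrm{ns}}$, and let $B<\infty$ be such that $\rho(\sigma,\tau)>2^{-B}$ whenever $\rho(\sigma,\tau)>0$. Entropies $H[\cdot]$ are in bits, and $h(p)=-p\log_2p-(1-p)\log_2(1-p)$.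 For $\ast\in\{\mathrm{pr},\mathrm{ns}\}$ let $\Gamma_\ast(f_i)$ consist of $f_i$ and of all $f_j$ for which $D_\ast$ has an arc $(\sigma,\tau)$ with $\pi(\sigma)=f_i$, $\sigma\notin f_j$, $\tau\in f_j$, and let $\mathrm{b}_\ast^{f_i}=\log_2\max_{\tau\in\Omega}|\{\sigma\in f_i:\rho_\ast(\sigma,\tau)>0\}|$ and $\mathrm{b}_\ast=\max_i \mathrm{b}_\ast^{f_i}$. Let $\Delta_i=|\Gamma_{\mathrm{ns}}(f_i)|$, $\Delta=\max_i\Delta_i$, $\Xi=\max\{\mathrm{b}_{\mathrm{ns}},\mathrm{b}_{\mathrm{pr}}\}$, $$\mathrm{Potential}(f_i)=\min_{\sigma:\pi(\sigma)=f_i}H[\rho(\sigma,\cdot)],\qquad q_i(p)=p\left(\Delta_i\left(\mathrm{b}_{\mathrm{ns}}+\tfrac52+h(p)\right)-2-h(p)\right)$$ (the minimum over the empty set being $+\infty$). Let $\sigma_1,\sigma_2,\dots$ be the Markov chain with transition probabilities $\rho$ started at an arbitrary fixed state. For $x>0$ let $\Sigma=\Sigma(x)$ be its shortest prefix $\sigma_1,\dots,\sigma_{t+1}$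 with $\prod_{k\le t}\rho(\sigma_k,\sigma_{k+1})\le 2^{-x}$ (the whole sequence if there is none), and let $P$ be the maximal prefix of $\Sigma$ all of whose states are flawed. **Theorem.** If there is $\lambda<1$ such that for all $j\in\{1,\dots,m\}$ $$\sum_{f_i\in\Gamma_{\mathrm{pr}}(f_j)}2^{-\left(\lambda\,\mathrm{Potential}(f_i)-\mathrm{b}_{\mathrm{pr}}^{f_i}-q_i(p)\right)}<2^{-(2+h(p))}$$ (a summand with $\mathrm{Potential}(f_i)=+\infty$ being $0$), then for every $x>0$ $$H[P]\le\lambda x+M_0,\qquad M_0=\log_2|\Omega|+m(\Delta+1)(\Xi+4)+\lambda B .$$ -/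

import Mathlib

noncomputable section

open MeasureTheory

/-- The summand `-r log₂ r` of the Shannon entropy in bits (it is `0` at `r = 0`). -/
def entropyTerm (r : ℝ) : ℝ := -(r * Real.logb 2 r)

/-- Shannon entropy (in bits) of a probability vector on a finite set. -/
def finEntropy {Ω : Type*} [Fintype Ω] (r : Ω → ℝ) : ℝ := ∑ τ, entropyTerm (r τ)

/-- The binary entropy function `h`, in bits. -/
def binEntropyBits (p : ℝ) : ℝ := -p * Real.logb 2 p - (1 - p) * Real.logb 2 (1 - p)

/-- Shannon entropy (in bits) of a random variable `Y` with values in a (countable) set `V`: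
the sum of `-Pr[Y = v] log₂ Pr[Y = v]`. It is meaningful when the family is summable. -/
def entropyBits {W V : Type*} [MeasurableSpace W] (μ : Measure W) (Y : W → V) : ℝ :=
  ∑' v, entropyTerm (μ.real {ω | Y ω = v})

/-- A finite state space `Ω` with `m` flaws, a priority order on the flaws, a principal transition
matrix, an arbitrary noise digraph carrying an arbitrary noise transition matrix, and a noise
intensity `p`. -/
structure NoisySystem (Ω : Type*) [Fintype Ω] (m : ℕ) where
  /-- the flaws `f_1, ..., f_m` -/
  flaw : Fin m → Set Ω
  /-- the priority order: `prio i` is the rank of `f_i`, rank `0` being the highest priority -/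
  prio : Equiv.Perm (Fin m)
  /-- the noise intensity -/
  p : ℝ
  p_mem : p ∈ Set.Icc (0 : ℝ) 1
  /-- the principal transition probabilities -/
  rhoPr : Ω → Ω → ℝ
  rhoPr_mem : ∀ σ, rhoPr σ ∈ stdSimplex ℝ Ω
  /-- a flawless state carries a principal self-loop of probability 1 -/
  rhoPr_flawless : ∀ σ, (∀ i, σ ∉ flaw i) → rhoPr σ σ = 1
  /-- the noise digraph -/
  Dns : Digraph Ω
  /-- the noise transition probabilities, a distribution on the arcs of `Dns` that leave `σ` -/
  rhoNs : Ω → Ω → ℝ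
  rhoNs_mem : ∀ σ, rhoNs σ ∈ stdSimplex ℝ Ω
  rhoNs_adj : ∀ σ τ, 0 < rhoNs σ τ → Dns.Adj σ τ

namespace NoisySystem

variable {Ω : Type*} [Fintype Ω] {m : ℕ} (S : NoisySystem Ω m)

/-- The transition probabilities `ρ = (1 - p) ρ_pr + p ρ_ns` of the analysed Markov chain. -/
def rho (σ τ : Ω) : ℝ := (1 - S.p) * S.rhoPr σ τ + S.p * S.rhoNs σ τ

/-- The digraph of possible principal transitions. -/
def Dpr : Digraph Ω where
  Adj σ τ := 0 < S.rhoPr σ τ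

/-- Some flaw is present in `σ`. -/
def Flawed (σ : Ω) : Prop := ∃ i, σ ∈ S.flaw i

/-- `π(σ) = f_i`: the flaw `f_i` is the highest priority flaw present in `σ`. -/
def Addressed (σ : Ω) (i : Fin m) : Prop :=
  σ ∈ S.flaw i ∧ ∀ j, σ ∈ S.flaw j → S.prio i ≤ S.prio j

/-- The arc `i → j` of the causality digraph `C(D)`: some arc `σ → τ` of `D` with label `i` has
`f_j` present in `τ` and absent from `σ`. -/
def Causes (D : Digraph Ω) (i j : Fin m) : Prop :=
  ∃ σ τ, D.Adj σ τ ∧ S.Addressed σ i ∧ τ ∈ S.flaw j ∧ σ ∉ S.flaw j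

open Classical in
/-- The neighborhood `Γ(f_i) = {f_i} ∪ {f_j : i → j in C(D)}`. -/
def neighborhood (D : Digraph Ω) (i : Fin m) : Finset (Fin m) :=
  Finset.univ.filter fun j => j = i ∨ S.Causes D i j

/-- `Potential(f_i)`: the minimum of `H[ρ(σ, ·)]` over the states `σ` with `π(σ) = f_i`.
For a flaw that is addressed at no state the real infimum below is meaningless
(the minimum is then `+∞`), and it is not used. -/
def potential (i : Fin m) : ℝ :=
  ⨅ σ : {σ // S.Addressed σ i}, finEntropy (S.rho σ)

open Classical in
/-- The maximum over `τ` of the number of `σ ∈ f_i` with `r σ τ > 0`. -/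
def congestion (r : Ω → Ω → ℝ) (i : Fin m) : ℕ :=
  Finset.univ.sup fun τ => (Finset.univ.filter fun σ => σ ∈ S.flaw i ∧ 0 < r σ τ).card

/-- `b_pr^{f_i}` -/
def bPr (i : Fin m) : ℝ := Real.logb 2 (S.congestion S.rhoPr i)

/-- `b_ns^{f_i}` -/
def bNs (i : Fin m) : ℝ := Real.logb 2 (S.congestion S.rhoNs i)

/-- `b_pr`, the maximum of the `b_pr^{f_i}` -/
def bPrMax : ℝ := ⨆ i, S.bPr i

/-- `b_ns`, the maximum of the `b_ns^{f_i}` -/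
def bNsMax : ℝ := ⨆ i, S.bNs i

/-- `Ξ = max {b_ns, b_pr}` -/
def Xi : ℝ := max S.bNsMax S.bPrMax

/-- `Δ_i = |Γ_ns(f_i)|` -/
def DeltaAt (i : Fin m) : ℕ := (S.neighborhood S.Dns i).card

/-- `Δ = max_i Δ_i` -/
def DeltaMax : ℕ := Finset.univ.sup S.DeltaAt

/-- `q_i(p)`, the efficiency lost to noise in addressing `f_i` -/
def q (i : Fin m) : ℝ :=
  S.p * (S.DeltaAt i * (S.bNsMax + 5 / 2 + binEntropyBits S.p) - 2 - binEntropyBits S.p)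

open Classical in
/-- For every `j`, the sum over `f_i ∈ Γ_pr(f_j)` of `2^{-(λ Potential(f_i) - b_pr^{f_i} - q_i(p))}`
is less than `2^{-(2 + h(p))}`. A flaw that is addressed at no state has potential `+∞`, so its
summand is `0`. -/
def Amenable (lam : ℝ) : Prop :=
  ∀ j, ∑ i ∈ (S.neighborhood S.Dpr j).filter (fun i => ∃ σ, S.Addressed σ i),
      (2 : ℝ) ^ (-(lam * S.potential i - S.bPr i - S.q i))
    < (2 : ℝ) ^ (-(2 + binEntropyBits S.p))

/-- `M₀ = log₂ |Ω| + m (Δ + 1) (Ξ + 4) + λ B` -/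
def M0 (lam B : ℝ) : ℝ :=
  Real.logb 2 (Fintype.card Ω) + m * (S.DeltaMax + 1) * (S.Xi + 4) + lam * B

/-- The probability `p_v` of the vertex `v = s 0, ..., s n` of the process tree rooted at `s 0`,
i.e. the product of the transition probabilities of the first `n` steps. -/
def pathProb (s : ℕ → Ω) (n : ℕ) : ℝ := ∏ k ∈ Finset.range n, S.rho (s k) (s (k + 1))

/-- The vertex `s 0, ..., s k` belongs to the process tree truncated at the first vertices of
probability at most `2^{-x}` (which are kept, as leaves): no proper prefix has probability at
most `2^{-x}`. -/
def InTruncation (x : ℝ) (s : ℕ → Ω) (k : ℕ) : Prop :=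
  ∀ n < k, (2 : ℝ) ^ (-x) < S.pathProb s n

/-- The number of states in the maximal bad prefix of the truncated trajectory: the largest `ℓ`
such that `s 0, ..., s (ℓ - 1)` are flawed and lie in the truncated tree. -/
def badLength (x : ℝ) (s : ℕ → Ω) : ℕ :=
  sSup {l | ∀ k < l, S.Flawed (s k) ∧ S.InTruncation x s k}

/-- The maximal bad prefix `P`, as the list of its states (empty if the first state is flawless). -/
def badPrefix (x : ℝ) (s : ℕ → Ω) : List Ω := (List.range (S.badLength x s)).map s

open Classical in
/-- `X 0, X 1, ...` is the Markov chain with transition matrix `ρ` started at `σ₁`. -/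
structure IsTrajectory {W : Type*} [MeasurableSpace W] (μ : Measure W) (σ₁ : Ω)
    (X : ℕ → W → Ω) : Prop where
  measurableSet_eq : ∀ k σ, MeasurableSet {ω | X k ω = σ}
  law : ∀ (s : ℕ → Ω) (n : ℕ),
    μ.real {ω | ∀ k ≤ n, X k ω = s k} = if s 0 = σ₁ then S.pathProb s n else 0

end NoisySystem

end

/-! The entropy of `P` is at most its expected code length. By Gibbs' inequality
(`sum_entropyTerm_le`), H[P] ≤ E[-log₂ y(P)] for every nonnegative y of total mass at most 1 that is
positive on the support of P. Here y is the product of `stepWeight` along the walk, divided by |Ω|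
2^m. Two estimates make this work.

Mass (`sum_walks_le`): walks are classified by the set E of pending flaws of their first state. E
reveals the flaw i addressed first, its member of highest priority. Given the kind of arc, the next
state and the next pending set, at most 2^b first states are possible, and the next pending set is E
\ {i} together with flaws of Γ(i). Induction on the number of steps bounds the mass of class E by
|Ω| ∏_{i ∈ E} T i, provided T = `flawWeight` satisfies a cluster-expansion condition
(`sum_stepWeights_le`). Summing over E gives |Ω| ∏ (1 + T i) ≤ |Ω| 2^m.

Cost (`sum_rho_mul_cost_le`): T is chosen so that from a flawed σ the expected -log₂ `stepWeight` is
at most λ H[ρ(σ,·)]. Summed over the active steps, the expected cost is at most λ times the expected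
revealed information -log₂ ρ, which is at most x + B on every path because truncation allows only
one step past x (`sum_active_information_le`).

Amenability forces positive potentials, so ρ is bounded away from 1 at flawed states; a finite
horizon N then suffices and all expectations are finite sums. -/

noncomputable section

open MeasureTheory

namespace NoisySystem

open Finset Classical

/-! ### Multiplicative weights of walks. -/

section ListWeight

variable {Ω : Type*}

/-- The product of the weights of the steps of a walk. -/
def listWeight (w : Ω → Ω → ℝ) : List Ω → ℝ
  | [] => 1
  | [_] => 1
  | a :: b :: l => w a b * listWeight w (b :: l)

lemma listWeight_map_range (w : Ω → Ω → ℝ) (n : ℕ) (s : ℕ → Ω) :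
    listWeight w ((List.range (n + 1)).map s) = ∏ k ∈ range n, w (s k) (s (k + 1)) := by
  induction n generalizing s with
  | zero => simp [listWeight]
  | succ n ih =>
    rw [prod_range_succ', ← ih (fun k => s (k + 1)), List.range_succ_eq_map, List.map_cons,
      List.map_map, List.range_succ_eq_map, List.map_cons, List.map_cons, listWeight, mul_comm]
    simp [Function.comp_def]

lemma listWeight_nonneg {w : Ω → Ω → ℝ} (hw : ∀ σ τ, 0 ≤ w σ τ) :
    ∀ l : List Ω, 0 ≤ listWeight w l
  | [] => zero_le_one
  | [_] => zero_le_one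
  | _ :: b :: l => mul_nonneg (hw _ _) (listWeight_nonneg hw (b :: l))

end ListWeight

/-! ### Total weight of walks, classified by pending flaws. -/

section Walks

variable {Ω : Type*} [Fintype Ω] {m : ℕ} (S : NoisySystem Ω m)

/-- The set of flaws present in a state. -/
def present (σ : Ω) : Finset (Fin m) := univ.filter fun i => σ ∈ S.flaw i

lemma mem_present {σ : Ω} {i : Fin m} : i ∈ S.present σ ↔ σ ∈ S.flaw i := by
  simp [present]

lemma Addressed.unique {S : NoisySystem Ω m} {σ : Ω} {i j : Fin m}
    (hi : S.Addressed σ i) (hj : S.Addressed σ j) : i = j :=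
  S.prio.injective (le_antisymm (hi.2 j hj.1) (hj.2 i hi.1))

lemma Flawed.exists_addressed {S : NoisySystem Ω m} {σ : Ω} (h : S.Flawed σ) :
    ∃ i, S.Addressed σ i := by
  obtain ⟨i, hi⟩ := h
  obtain ⟨j, hj, hmin⟩ := (S.present σ).exists_min_image S.prio ⟨i, S.mem_present.2 hi⟩
  exact ⟨j, S.mem_present.1 hj, fun k hk => hmin k (S.mem_present.2 hk)⟩

/-- The total weight of the walks with at most `n` steps that start at `σ` and leave flawed states
only, where `E` is the set of the flaws present in `σ` that stay present until they are addressed.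
A step out of `σ` to `τ` that addresses `i` has weight `κ i σ τ`. -/
def walkMass (κ : Fin m → Ω → Ω → ℝ) : ℕ → Ω → Finset (Fin m) → ℝ
  | 0, _, E => if E = ∅ then 1 else 0
  | n + 1, σ, E => (if E = ∅ then 1 else 0) + ∑ i, ∑ τ, ∑ E',
      if S.Addressed σ i ∧ E = insert i (E' ∩ S.present σ) then
        κ i σ τ * walkMass κ n τ E' else 0

lemma walkMass_nonneg {κ : Fin m → Ω → Ω → ℝ} (hκ : ∀ i σ τ, 0 ≤ κ i σ τ) (n : ℕ) :
    ∀ σ E, 0 ≤ S.walkMass κ n σ E := by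
  induction n with
  | zero => intro σ E; rw [walkMass]; split_ifs <;> norm_num
  | succ n ih =>
    intro σ E
    rw [walkMass]
    refine add_nonneg (by split_ifs <;> norm_num) ?_
    refine sum_nonneg fun i _ => sum_nonneg fun τ _ => sum_nonneg fun E' _ => ?_
    split_ifs
    · exact mul_nonneg (hκ _ _ _) (ih _ _)
    · exact le_rfl

lemma walkMass_eq_zero {κ : Fin m → Ω → Ω → ℝ} (n : ℕ) (σ : Ω) (E : Finset (Fin m))
    (hE : ¬ E ⊆ S.present σ) : S.walkMass κ n σ E = 0 := by
  have h0 : E ≠ ∅ := by rintro rfl; exact hE (empty_subset _)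
  cases n with
  | zero => rw [walkMass, if_neg h0]
  | succ n =>
    rw [walkMass, if_neg h0, zero_add]
    refine sum_eq_zero fun i _ => sum_eq_zero fun τ _ => sum_eq_zero fun E' _ => if_neg ?_
    rintro ⟨hi, rfl⟩
    exact hE (insert_subset (S.mem_present.2 hi.1) inter_subset_right)

/-- Every walk has exactly one pending set, since i, σ and E' determine E; summing over E therefore
forgets the classification. -/
lemma sum_walkMass_succ (κ : Fin m → Ω → Ω → ℝ) (n : ℕ) (σ : Ω) :
    ∑ E, S.walkMass κ (n + 1) σ E =
      1 + ∑ τ, (∑ i, if S.Addressed σ i then κ i σ τ else 0) * ∑ E, S.walkMass κ n τ E := by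
  simp only [walkMass]
  rw [sum_add_distrib, sum_ite_eq' univ ∅ (fun _ => (1 : ℝ)), if_pos (mem_univ _)]
  congr 1
  rw [sum_comm]
  simp only [sum_mul]
  rw [sum_comm (s := univ) (t := univ) (f := fun (τ : Ω) (i : Fin m) => _ * _)]
  refine sum_congr rfl fun i _ => ?_
  rw [sum_comm]
  refine sum_congr rfl fun τ _ => ?_
  rw [sum_comm, mul_sum]
  refine sum_congr rfl fun E' _ => ?_
  by_cases h : S.Addressed σ i
  · simp [h]
  · simp [h]

/-- A sum over the sets that extend `F` by elements of `G` of the products of nonnegative weights. -/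
lemma sum_prod_extensions_le {ι : Type*} [Fintype ι] [DecidableEq ι] {T : ι → ℝ} (hT : ∀ i, 0 ≤ T i)
    (F G : Finset ι) :
    ∑ E', (if F ⊆ E' ∧ E' \ F ⊆ G then ∏ i ∈ E', T i else 0) ≤
      (∏ i ∈ F, T i) * ∏ i ∈ G, (1 + T i) := by
  rw [← sum_filter, prod_one_add, mul_sum]
  have hinj : Set.InjOn (fun E' : Finset ι => E' \ F)
      (univ.filter fun E' => F ⊆ E' ∧ E' \ F ⊆ G) := by
    intro A hA A' hA' h
    rw [mem_coe, mem_filter] at hA hA'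
    have h' : A \ F = A' \ F := h
    rw [← sdiff_union_of_subset hA.2.1, ← sdiff_union_of_subset hA'.2.1, h']
  calc _ = ∑ E' ∈ univ.filter (fun E' => F ⊆ E' ∧ E' \ F ⊆ G),
        (∏ i ∈ F, T i) * ∏ i ∈ E' \ F, T i := by
        refine sum_congr rfl fun E' hE' => ?_
        rw [mul_comm, prod_sdiff (mem_filter.1 hE').2.1]
    _ = ∑ A ∈ (univ.filter fun E' => F ⊆ E' ∧ E' \ F ⊆ G).image (fun E' => E' \ F),
        (∏ i ∈ F, T i) * ∏ i ∈ A, T i :=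
        (sum_image (f := fun A => (∏ i ∈ F, T i) * ∏ i ∈ A, T i) hinj).symm
    _ ≤ _ := by
        refine sum_le_sum_of_subset_of_nonneg ?_ fun A _ _ =>
          mul_nonneg (prod_nonneg fun i _ => hT i) (prod_nonneg fun i _ => hT i)
        intro A hA
        obtain ⟨E', hE', rfl⟩ := mem_image.1 hA
        exact mem_powerset.2 (mem_filter.1 hE').2.2

lemma card_le_congestion (r : Ω → Ω → ℝ) (i : Fin m) (τ : Ω) :
    (univ.filter fun σ => σ ∈ S.flaw i ∧ 0 < r σ τ).card ≤ S.congestion r i :=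
  le_sup (f := fun τ => (univ.filter fun σ => σ ∈ S.flaw i ∧ 0 < r σ τ).card) (mem_univ τ)

/-- The flaws pending after a step along `D` that addresses `i` are the other flaws pending before
it, and flaws of the neighborhood of `i`. -/
lemma pending_step {D : Digraph Ω} {i : Fin m} {σ τ : Ω} {E E' : Finset (Fin m)}
    (hi : S.Addressed σ i) (hD : D.Adj σ τ) (hE' : E' ⊆ S.present τ)
    (hE : E = insert i (E' ∩ S.present σ)) :
    E.erase i ⊆ E' ∧ E' \ E.erase i ⊆ S.neighborhood D i := by
  subst hE
  constructor
  · intro j hj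
    rw [mem_erase, mem_insert, mem_inter] at hj
    exact (hj.2.resolve_left hj.1).1
  · intro j hj
    rw [mem_sdiff, mem_erase, mem_insert, mem_inter] at hj
    rw [neighborhood, mem_filter]
    refine ⟨mem_univ _, ?_⟩
    by_cases hji : j = i
    · exact Or.inl hji
    · refine Or.inr ⟨σ, τ, hD, hi, S.mem_present.1 (hE' hj.1), fun hσ => ?_⟩
      exact hj.2 ⟨hji, Or.inr ⟨hj.1, S.mem_present.2 hσ⟩⟩

/-- The inductive step of the mass bound for one kind of arc. With τ and E' fixed, the predecessors
σ are counted by the congestion; then `hVT` handles the sum over τ and `sum_prod_extensions_le` the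
sum over E'. -/
lemma sum_step_le {D : Digraph Ω} {r : Ω → Ω → ℝ} (hr : ∀ σ τ, 0 < r σ τ → D.Adj σ τ)
    {T : Fin m → ℝ} (hT : ∀ i, 0 ≤ T i) {C : ℝ} (hC : 0 ≤ C) {V : Ω → Finset (Fin m) → ℝ}
    (hV : ∀ τ E, 0 ≤ V τ E) (hV0 : ∀ τ E, ¬ E ⊆ S.present τ → V τ E = 0)
    (hVT : ∀ E, ∑ τ, V τ E ≤ C * ∏ i ∈ E, T i) (i : Fin m) (E : Finset (Fin m)) :
    ∑ σ, ∑ τ, ∑ E', (if S.Addressed σ i ∧ E = insert i (E' ∩ S.present σ) then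
        (if 0 < r σ τ then V τ E' else 0) else 0) ≤
      S.congestion r i * (C * ((∏ j ∈ E.erase i, T j) * ∏ j ∈ S.neighborhood D i, (1 + T j))) := by
  calc _ ≤ ∑ σ, ∑ τ, ∑ E', (if E.erase i ⊆ E' ∧ E' \ E.erase i ⊆ S.neighborhood D i then
        (if σ ∈ S.flaw i ∧ 0 < r σ τ then V τ E' else 0) else 0) := by
        refine sum_le_sum fun σ _ => sum_le_sum fun τ _ => sum_le_sum fun E' _ => ?_
        have hn : (0 : ℝ) ≤ if E.erase i ⊆ E' ∧ E' \ E.erase i ⊆ S.neighborhood D i then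
            (if σ ∈ S.flaw i ∧ 0 < r σ τ then V τ E' else 0) else 0 := by
          split_ifs
          · exact hV _ _
          all_goals exact le_rfl
        by_cases h1 : S.Addressed σ i ∧ E = insert i (E' ∩ S.present σ)
        · rw [if_pos h1]
          by_cases h2 : 0 < r σ τ
          · rw [if_pos h2]
            by_cases h3 : E' ⊆ S.present τ
            · rw [if_pos (S.pending_step h1.1 (hr _ _ h2) h3 h1.2), if_pos ⟨h1.1.1, h2⟩]
            · rw [hV0 _ _ h3]
              simp
          · rwa [if_neg h2]
        · rwa [if_neg h1]
    _ = ∑ E', if E.erase i ⊆ E' ∧ E' \ E.erase i ⊆ S.neighborhood D i then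
        ∑ τ, ((univ.filter fun σ => σ ∈ S.flaw i ∧ 0 < r σ τ).card : ℝ) * V τ E' else 0 := by
        -- The sum over σ becomes innermost, where only the number of predecessors of τ remains.
        rw [sum_comm, sum_congr rfl fun τ _ => sum_comm, sum_comm]
        refine sum_congr rfl fun E' _ => ?_
        split_ifs
        · refine sum_congr rfl fun τ _ => ?_
          rw [← sum_filter, sum_const, nsmul_eq_mul]
        · simp
    _ ≤ ∑ E', S.congestion r i * (C *
        if E.erase i ⊆ E' ∧ E' \ E.erase i ⊆ S.neighborhood D i then ∏ j ∈ E', T j else 0) := by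
        refine sum_le_sum fun E' _ => ?_
        split_ifs
        · calc _ ≤ ∑ τ, (S.congestion r i : ℝ) * V τ E' :=
                sum_le_sum fun τ _ => mul_le_mul_of_nonneg_right
                  (by exact_mod_cast S.card_le_congestion r i τ) (hV _ _)
            _ ≤ _ := by
                rw [← mul_sum]
                exact mul_le_mul_of_nonneg_left (hVT E') (Nat.cast_nonneg _)
        · simp
    _ ≤ _ := by
        rw [← mul_sum, ← mul_sum]
        gcongr
        exact sum_prod_extensions_le hT _ _

/-- The sum over the start states of the weights of the walks with given pending flaws `E` is at
most `|Ω| ∏_{i ∈ E} T i`, if the weights `T` satisfy a cluster-expansion type condition. -/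
lemma sum_walkMass_le {a b T : Fin m → ℝ} (ha : ∀ i, 0 ≤ a i) (hb : ∀ i, 0 ≤ b i)
    (hT : ∀ i, 0 ≤ T i)
    (habT : ∀ i, a i * (S.congestion S.rhoPr i * ∏ j ∈ S.neighborhood S.Dpr i, (1 + T j)) +
      b i * (S.congestion S.rhoNs i * ∏ j ∈ S.neighborhood S.Dns i, (1 + T j)) ≤ T i) (n : ℕ) :
    ∀ E, ∑ σ, S.walkMass (fun i σ τ => a i * (if 0 < S.rhoPr σ τ then 1 else 0) +
      b i * (if 0 < S.rhoNs σ τ then 1 else 0)) n σ E ≤ Fintype.card Ω * ∏ i ∈ E, T i := by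
  set κ : Fin m → Ω → Ω → ℝ := fun i σ τ => a i * (if 0 < S.rhoPr σ τ then 1 else 0) +
      b i * (if 0 < S.rhoNs σ τ then 1 else 0) with hκdef
  have hκ : ∀ i σ τ, 0 ≤ κ i σ τ := fun i σ τ =>
    add_nonneg (mul_nonneg (ha i) (by split_ifs <;> norm_num))
      (mul_nonneg (hb i) (by split_ifs <;> norm_num))
  induction n with
  | zero =>
    intro E
    by_cases hE : E = ∅
    · simp [walkMass, hE]
    · simp only [walkMass, if_neg hE, sum_const_zero]
      exact mul_nonneg (Nat.cast_nonneg _) (prod_nonneg fun i _ => hT i)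
  | succ n ih =>
    intro E
    by_cases hE : E = ∅
    · simp only [walkMass, hE, prod_empty, mul_one, if_true]
      refine le_of_eq ?_
      rw [sum_congr rfl (g := fun _ => (1 : ℝ))]
      · simp
      · intro σ _
        rw [add_eq_left]
        refine sum_eq_zero fun i _ => sum_eq_zero fun τ _ => sum_eq_zero fun E' _ => if_neg ?_
        exact fun h => insert_ne_empty _ _ h.2.symm
    -- The first addressed flaw can be read off E: it lies in E, E consists of flaws present in σ,
    -- and it has the highest priority among those.
    · obtain ⟨i₀, hi₀, hmin⟩ := E.exists_min_image S.prio (nonempty_iff_ne_empty.2 hE)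
      have hi : ∀ σ i (E' : Finset (Fin m)),
          S.Addressed σ i ∧ E = insert i (E' ∩ S.present σ) → i = i₀ := by
        rintro σ i E' ⟨h1, h2⟩
        have hsub : E ⊆ S.present σ := by
          rw [h2]; exact insert_subset (S.mem_present.2 h1.1) inter_subset_right
        have hiE : i ∈ E := by rw [h2]; exact mem_insert_self _ _
        exact S.prio.injective
          (le_antisymm (h1.2 _ (S.mem_present.1 (hsub hi₀))) (hmin i hiE))
      have hstep : ∀ σ, S.walkMass κ (n + 1) σ E = ∑ τ, ∑ E',
          if S.Addressed σ i₀ ∧ E = insert i₀ (E' ∩ S.present σ) then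
            κ i₀ σ τ * S.walkMass κ n τ E' else 0 := by
        intro σ
        rw [walkMass, if_neg hE, zero_add]
        refine sum_eq_single i₀ (fun i _ hne => ?_) (fun h => absurd (mem_univ _) h)
        exact sum_eq_zero fun τ _ => sum_eq_zero fun E' _ =>
          if_neg fun h => hne (hi σ i E' h)
      have hV := S.walkMass_nonneg hκ n
      have hV0 := S.walkMass_eq_zero (κ := κ) n
      have hC : (0 : ℝ) ≤ Fintype.card Ω := Nat.cast_nonneg _
      have h1 := S.sum_step_le (D := S.Dpr) (r := S.rhoPr) (fun _ _ h => h) hT hC hV hV0 ih i₀ E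
      have h2 := S.sum_step_le (D := S.Dns) (r := S.rhoNs) S.rhoNs_adj hT hC hV hV0 ih i₀ E
      have hsplit : ∑ σ, S.walkMass κ (n + 1) σ E =
          a i₀ * (∑ σ, ∑ τ, ∑ E',
            (if S.Addressed σ i₀ ∧ E = insert i₀ (E' ∩ S.present σ) then
              (if 0 < S.rhoPr σ τ then S.walkMass κ n τ E' else 0) else 0)) +
          b i₀ * (∑ σ, ∑ τ, ∑ E',
            (if S.Addressed σ i₀ ∧ E = insert i₀ (E' ∩ S.present σ) then
              (if 0 < S.rhoNs σ τ then S.walkMass κ n τ E' else 0) else 0)) := by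
        simp only [mul_sum, ← sum_add_distrib]
        refine sum_congr rfl fun σ _ => ?_
        rw [hstep]
        refine sum_congr rfl fun τ _ => sum_congr rfl fun E' _ => ?_
        by_cases h : S.Addressed σ i₀ ∧ E = insert i₀ (E' ∩ S.present σ)
        · simp only [if_pos h, hκdef, add_mul, mul_assoc, ite_mul, one_mul, zero_mul]
        · simp only [if_neg h, mul_zero, add_zero]
      rw [hsplit, ← mul_prod_erase E T hi₀]
      have hP : 0 ≤ (Fintype.card Ω : ℝ) * ∏ j ∈ E.erase i₀, T j :=
        mul_nonneg hC (prod_nonneg fun i _ => hT i)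
      calc _ ≤ _ := add_le_add (mul_le_mul_of_nonneg_left h1 (ha i₀))
              (mul_le_mul_of_nonneg_left h2 (hb i₀))
        _ = ((Fintype.card Ω : ℝ) * ∏ j ∈ E.erase i₀, T j) *
            (a i₀ * (S.congestion S.rhoPr i₀ * ∏ j ∈ S.neighborhood S.Dpr i₀, (1 + T j)) +
            b i₀ * (S.congestion S.rhoNs i₀ * ∏ j ∈ S.neighborhood S.Dns i₀, (1 + T j))) := by
            ring
        _ ≤ ((Fintype.card Ω : ℝ) * ∏ j ∈ E.erase i₀, T j) * T i₀ :=
            mul_le_mul_of_nonneg_left (habT i₀) hP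
        _ = _ := by ring

/-- The walks with at most `n` steps that start at a given state, as lists of states. -/
def walks : ℕ → Ω → Finset (List Ω)
  | 0, σ => {[σ]}
  | n + 1, σ => insert [σ] (univ.biUnion fun τ => (walks n τ).image (List.cons σ))

lemma mem_walks (l : List Ω) : ∀ (n : ℕ) (σ : Ω), l.length ≤ n → σ :: l ∈ walks n σ := by
  induction l with
  | nil => intro n σ _; cases n <;> simp [walks]
  | cons τ l ih =>
    intro n σ h
    cases n with
    | zero => simp at h
    | succ n =>
      rw [walks]
      refine mem_insert_of_mem (mem_biUnion.2 ⟨τ, mem_univ _, mem_image_of_mem _ (ih n τ ?_)⟩)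
      simpa using h

lemma exists_cons_of_mem_walks {n : ℕ} {σ : Ω} {l : List Ω} (h : l ∈ walks n σ) :
    ∃ l', l = σ :: l' := by
  cases n with
  | zero => exact ⟨[], by simpa [walks] using h⟩
  | succ n =>
    rw [walks, mem_insert, mem_biUnion] at h
    rcases h with rfl | ⟨τ, _, h⟩
    · exact ⟨[], rfl⟩
    · obtain ⟨l', _, rfl⟩ := mem_image.1 h
      exact ⟨l', rfl⟩

/-- Passes from explicit lists to the recursion: both sides split off the one-state walk and then
the first step. -/
lemma sum_listWeight_le {κ : Fin m → Ω → Ω → ℝ} (hκ : ∀ i σ τ, 0 ≤ κ i σ τ) (n : ℕ) : ∀ σ,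
    ∑ l ∈ walks n σ, listWeight (fun σ τ => ∑ i, if S.Addressed σ i then κ i σ τ else 0) l ≤
      ∑ E, S.walkMass κ n σ E := by
  set w : Ω → Ω → ℝ := fun σ τ => ∑ i, if S.Addressed σ i then κ i σ τ else 0 with hwdef
  have hw : ∀ σ τ, 0 ≤ w σ τ := fun σ τ => sum_nonneg fun i _ => by
    split_ifs
    · exact hκ _ _ _
    · exact le_rfl
  induction n with
  | zero => intro σ; simp [walks, walkMass, listWeight]
  | succ n ih =>
    intro σ
    rw [sum_walkMass_succ, walks]
    have hnot : [σ] ∉ univ.biUnion fun τ => (walks n τ).image (List.cons σ) := by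
      intro h
      obtain ⟨τ, _, h⟩ := mem_biUnion.1 h
      obtain ⟨l, hl, h⟩ := mem_image.1 h
      obtain ⟨l', rfl⟩ := exists_cons_of_mem_walks hl
      simp at h
    rw [sum_insert hnot]
    refine add_le_add (by simp [listWeight]) ?_
    rw [sum_biUnion]
    · refine sum_le_sum fun τ _ => ?_
      rw [sum_image (fun _ _ _ _ h => (List.cons.inj h).2)]
      calc _ = ∑ l ∈ walks n τ, w σ τ * listWeight w l := by
            refine sum_congr rfl fun l hl => ?_
            obtain ⟨l', rfl⟩ := exists_cons_of_mem_walks hl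
            rfl
        _ ≤ _ := by
            rw [← mul_sum]
            exact mul_le_mul_of_nonneg_left (ih τ) (hw _ _)
    · intro τ _ τ' _ hne
      refine disjoint_left.2 fun l hl hl' => hne ?_
      obtain ⟨l₁, h₁, rfl⟩ := mem_image.1 hl
      obtain ⟨l₂, h₂, h⟩ := mem_image.1 hl'
      obtain ⟨k₁, rfl⟩ := exists_cons_of_mem_walks h₁
      obtain ⟨k₂, rfl⟩ := exists_cons_of_mem_walks h₂
      simp at h
      exact h.1.symm

end Walks

/-! ### Step weights: their total mass and their expected cost. -/

section Cost

variable {Ω : Type*} [Fintype Ω] {m : ℕ} (S : NoisySystem Ω m)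

lemma entropyTerm_nonneg {r : ℝ} (h0 : 0 ≤ r) (h1 : r ≤ 1) : 0 ≤ entropyTerm r := by
  rw [entropyTerm, Left.nonneg_neg_iff]
  exact mul_nonpos_of_nonneg_of_nonpos h0 (Real.logb_nonpos one_lt_two h0 h1)

lemma binEntropyBits_nonneg {p : ℝ} (hp : p ∈ Set.Icc (0 : ℝ) 1) : 0 ≤ binEntropyBits p := by
  have h1 := entropyTerm_nonneg hp.1 hp.2
  have h2 := entropyTerm_nonneg (sub_nonneg.2 hp.2) (sub_le_self 1 hp.1)
  simp only [entropyTerm, binEntropyBits] at *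
  linarith

lemma logb_natCast_nonneg (n : ℕ) : 0 ≤ Real.logb 2 n := by
  rcases Nat.eq_zero_or_pos n with rfl | h
  · simp
  · exact Real.logb_nonneg one_lt_two (by exact_mod_cast h)

lemma natCast_le_two_rpow_logb (n : ℕ) : (n : ℝ) ≤ (2 : ℝ) ^ Real.logb 2 n := by
  rcases Nat.eq_zero_or_pos n with rfl | h
  · simp
  · rw [Real.rpow_logb two_pos (by norm_num) (by exact_mod_cast h)]

lemma bPr_nonneg (i : Fin m) : 0 ≤ S.bPr i := logb_natCast_nonneg _

lemma bNs_nonneg (i : Fin m) : 0 ≤ S.bNs i := logb_natCast_nonneg _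

lemma bNs_le_bNsMax (i : Fin m) : S.bNs i ≤ S.bNsMax :=
  le_ciSup (f := S.bNs) (Set.finite_range _).bddAbove i

lemma bNsMax_nonneg : 0 ≤ S.bNsMax := Real.iSup_nonneg S.bNs_nonneg

lemma Xi_nonneg : 0 ≤ S.Xi := le_max_of_le_left S.bNsMax_nonneg

lemma one_le_DeltaAt (i : Fin m) : 1 ≤ S.DeltaAt i :=
  card_pos.2 ⟨i, mem_filter.2 ⟨mem_univ _, Or.inl rfl⟩⟩

lemma self_mem_neighborhood (D : Digraph Ω) (i : Fin m) : i ∈ S.neighborhood D i :=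
  mem_filter.2 ⟨mem_univ _, Or.inl rfl⟩

lemma rho_mem (σ : Ω) : S.rho σ ∈ stdSimplex ℝ Ω :=
  convex_stdSimplex ℝ Ω (S.rhoPr_mem σ) (S.rhoNs_mem σ) (sub_nonneg.2 S.p_mem.2) S.p_mem.1
    (sub_add_cancel 1 S.p)

lemma rho_nonneg (σ τ : Ω) : 0 ≤ S.rho σ τ := (S.rho_mem σ).1 τ

lemma sum_rho (σ : Ω) : ∑ τ, S.rho σ τ = 1 := (S.rho_mem σ).2

lemma rho_le_one (σ τ : Ω) : S.rho σ τ ≤ 1 := by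
  rw [← S.sum_rho σ]
  exact single_le_sum (fun τ _ => S.rho_nonneg σ τ) (mem_univ τ)

lemma finEntropy_rho_nonneg (σ : Ω) : 0 ≤ finEntropy (S.rho σ) :=
  sum_nonneg fun τ _ => entropyTerm_nonneg (S.rho_nonneg σ τ) (S.rho_le_one σ τ)

lemma potential_nonneg (i : Fin m) : 0 ≤ S.potential i :=
  Real.iInf_nonneg fun σ => S.finEntropy_rho_nonneg σ

lemma potential_le {σ : Ω} {i : Fin m} (h : S.Addressed σ i) :
    S.potential i ≤ finEntropy (S.rho σ) :=
  ciInf_le (f := fun σ : {σ // S.Addressed σ i} => finEntropy (S.rho σ))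
    (Set.finite_range _).bddBelow ⟨σ, h⟩

/-- A noise step costs b_ns + Δ_i bits where a principal step is charged b_pr + 1; this is the part
of the loss that `q` has to cover. -/
lemma le_q (i : Fin m) : S.p * (S.bNs i + S.DeltaAt i - 1) ≤ S.q i := by
  refine mul_le_mul_of_nonneg_left ?_ S.p_mem.1
  have h1 := S.bNs_le_bNsMax i
  have h2 := S.bNsMax_nonneg
  have h3 := binEntropyBits_nonneg S.p_mem
  have h4 : (1 : ℝ) ≤ S.DeltaAt i := by exact_mod_cast S.one_le_DeltaAt i
  nlinarith [mul_nonneg (sub_nonneg.2 h4) h2, mul_nonneg (sub_nonneg.2 h4) h3]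

lemma q_nonneg (i : Fin m) : 0 ≤ S.q i := by
  refine le_trans (mul_nonneg S.p_mem.1 ?_) (S.le_q i)
  have h1 := S.bNs_nonneg i
  have h4 : (1 : ℝ) ≤ S.DeltaAt i := by exact_mod_cast S.one_le_DeltaAt i
  linarith

/-- The weight of a flaw: an encoding of the walks charges it once for each time it is addressed. -/
def flawWeight (lam : ℝ) (i : Fin m) : ℝ :=
  if ∃ σ, S.Addressed σ i then
    (2 : ℝ) ^ (1 + binEntropyBits S.p) * (2 : ℝ) ^ (-(lam * S.potential i - S.bPr i - S.q i))
  else 0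

variable {S} {lam : ℝ}

lemma flawWeight_nonneg (i : Fin m) : 0 ≤ S.flawWeight lam i := by
  rw [flawWeight]
  split_ifs <;> positivity

lemma flawWeight_pos {i : Fin m} (h : ∃ σ, S.Addressed σ i) : 0 < S.flawWeight lam i := by
  rw [flawWeight, if_pos h]
  positivity

lemma logb_flawWeight {i : Fin m} (h : ∃ σ, S.Addressed σ i) :
    Real.logb 2 (S.flawWeight lam i) =
      1 + binEntropyBits S.p - (lam * S.potential i - S.bPr i - S.q i) := by
  rw [flawWeight, if_pos h, ← Real.rpow_add two_pos, Real.logb_rpow two_pos (by norm_num)]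
  ring

/-- The factor 2^(1 + h) in `flawWeight` uses up all but one bit of the slack 2^(-(2 + h)) in the
amenability condition. -/
lemma Amenable.sum_flawWeight_le (hS : S.Amenable lam) (j : Fin m) :
    ∑ i ∈ S.neighborhood S.Dpr j, S.flawWeight lam i ≤ 1 / 2 := by
  have h := (hS j).le
  simp only [flawWeight]
  rw [← sum_filter, ← mul_sum]
  calc _ ≤ (2 : ℝ) ^ (1 + binEntropyBits S.p) * (2 : ℝ) ^ (-(2 + binEntropyBits S.p)) :=
        mul_le_mul_of_nonneg_left h (by positivity)
    _ = (2 : ℝ) ^ (-1 : ℝ) := by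
        rw [← Real.rpow_add two_pos]
        congr 1
        ring
    _ = 1 / 2 := by rw [Real.rpow_neg_one]; norm_num

lemma Amenable.flawWeight_le (hS : S.Amenable lam) (i : Fin m) : S.flawWeight lam i ≤ 1 / 2 :=
  (single_le_sum (f := S.flawWeight lam) (fun j _ => flawWeight_nonneg j)
    (S.self_mem_neighborhood S.Dpr i)).trans (hS.sum_flawWeight_le i)

/-- A flaw weight below 1 forces λ Potential ≥ 1 + h + b_pr + q. This is the source of the signs of
λ and of the potential. -/
lemma Amenable.mul_potential_pos (hS : S.Amenable lam) {i : Fin m} (h : ∃ σ, S.Addressed σ i) :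
    0 < lam * S.potential i := by
  have h1 : Real.logb 2 (S.flawWeight lam i) ≤ 0 :=
    Real.logb_nonpos one_lt_two (flawWeight_nonneg i) ((hS.flawWeight_le i).trans (by norm_num))
  rw [logb_flawWeight h] at h1
  linarith [S.bPr_nonneg i, S.q_nonneg i, binEntropyBits_nonneg S.p_mem]

lemma Amenable.potential_pos (hS : S.Amenable lam) {i : Fin m} (h : ∃ σ, S.Addressed σ i) :
    0 < S.potential i :=
  (S.potential_nonneg i).lt_of_ne fun h0 => by
    simpa [← h0] using hS.mul_potential_pos h

lemma Amenable.lam_pos (hS : S.Amenable lam) {i : Fin m} (h : ∃ σ, S.Addressed σ i) : 0 < lam :=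
  (pos_iff_pos_of_mul_pos (hS.mul_potential_pos h)).2 (hS.potential_pos h)

variable (S lam)

/-- The weight of a principal step that addresses `i`. -/
def prWeight (i : Fin m) : ℝ :=
  (1 - S.p) * ((2 : ℝ) ^ (-S.bPr i) * (S.flawWeight lam i / 2))

/-- The weight of a noise step that addresses `i`. -/
def nsWeight (i : Fin m) : ℝ :=
  S.p * ((2 : ℝ) ^ (-S.bNs i) * (S.flawWeight lam i * (2 : ℝ) ^ (-(S.DeltaAt i : ℝ))))

/-- The weight of a transition out of a flawed state (`0` out of a flawless state). -/
def stepWeight (σ τ : Ω) : ℝ :=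
  ∑ i, if S.Addressed σ i then S.prWeight lam i * (if 0 < S.rhoPr σ τ then 1 else 0) +
    S.nsWeight lam i * (if 0 < S.rhoNs σ τ then 1 else 0) else 0

variable {S lam}

lemma stepWeight_eq {σ : Ω} {i : Fin m} (h : S.Addressed σ i) (τ : Ω) :
    S.stepWeight lam σ τ = S.prWeight lam i * (if 0 < S.rhoPr σ τ then 1 else 0) +
      S.nsWeight lam i * (if 0 < S.rhoNs σ τ then 1 else 0) := by
  rw [stepWeight, sum_eq_single i, if_pos h]
  · exact fun j _ hj => if_neg fun h' => hj (h'.unique h)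
  · exact fun h' => absurd (mem_univ _) h'

lemma prWeight_nonneg (i : Fin m) : 0 ≤ S.prWeight lam i := by
  have := flawWeight_nonneg (S := S) (lam := lam) i
  have := sub_nonneg.2 S.p_mem.2
  rw [prWeight]
  positivity

lemma nsWeight_nonneg (i : Fin m) : 0 ≤ S.nsWeight lam i := by
  have := flawWeight_nonneg (S := S) (lam := lam) i
  have := S.p_mem.1
  rw [nsWeight]
  positivity

lemma stepWeight_nonneg (σ τ : Ω) : 0 ≤ S.stepWeight lam σ τ := by
  refine sum_nonneg fun i _ => ?_
  have := prWeight_nonneg (S := S) (lam := lam) i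
  have := nsWeight_nonneg (S := S) (lam := lam) i
  split_ifs <;> simp <;> linarith

lemma congestion_mul_two_rpow_le (r : Ω → Ω → ℝ) (i : Fin m) :
    (S.congestion r i : ℝ) * (2 : ℝ) ^ (-Real.logb 2 (S.congestion r i)) ≤ 1 := by
  rw [Real.rpow_neg two_pos.le, ← div_eq_mul_inv]
  exact div_le_one_of_le₀ (natCast_le_two_rpow_logb _) (by positivity)

/-- The product is at most exp(1/2) < 2, which is paid for by the factor 1/2 in `prWeight`. -/
lemma Amenable.prod_one_add_le (hS : S.Amenable lam) (i : Fin m) :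
    ∏ j ∈ S.neighborhood S.Dpr i, (1 + S.flawWeight lam j) ≤ 2 := by
  calc _ ≤ ∏ j ∈ S.neighborhood S.Dpr i, Real.exp (S.flawWeight lam j) :=
        prod_le_prod (fun j _ => by linarith [flawWeight_nonneg (S := S) (lam := lam) j])
          fun j _ => by linarith [Real.add_one_le_exp (S.flawWeight lam j)]
    _ = Real.exp (∑ j ∈ S.neighborhood S.Dpr i, S.flawWeight lam j) := (Real.exp_sum _ _).symm
    _ ≤ Real.exp (1 / 2) := Real.exp_le_exp.2 (hS.sum_flawWeight_le i)
    _ ≤ 2 := by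
        refine le_of_sq_le_sq ?_ two_pos.le
        rw [← Real.exp_nat_mul]
        have := Real.exp_one_lt_d9
        norm_num
        linarith

lemma Amenable.prod_one_add_le_pow (hS : S.Amenable lam) (G : Finset (Fin m)) :
    ∏ j ∈ G, (1 + S.flawWeight lam j) ≤ (2 : ℝ) ^ G.card :=
  (prod_le_prod (fun j _ => by linarith [flawWeight_nonneg (S := S) (lam := lam) j])
    fun j _ => by linarith [hS.flawWeight_le j]).trans (prod_const 2).le

/-- The factors 2^(-b) in the step weights cancel the congestions, while 1/2 and 2^(-Δ_i) cancel the
neighborhood products; what remains is (1 - p) T + p T. -/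
lemma Amenable.sum_stepWeights_le (hS : S.Amenable lam) (i : Fin m) :
    S.prWeight lam i * (S.congestion S.rhoPr i *
        ∏ j ∈ S.neighborhood S.Dpr i, (1 + S.flawWeight lam j)) +
      S.nsWeight lam i * (S.congestion S.rhoNs i *
        ∏ j ∈ S.neighborhood S.Dns i, (1 + S.flawWeight lam j)) ≤ S.flawWeight lam i := by
  have hT := flawWeight_nonneg (S := S) (lam := lam) i
  have hp := S.p_mem.1
  have hp' := sub_nonneg.2 S.p_mem.2
  have h1 := congestion_mul_two_rpow_le (S := S) S.rhoPr i
  have h2 := congestion_mul_two_rpow_le (S := S) S.rhoNs i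
  have h3 := hS.prod_one_add_le i
  have h4 : (∏ j ∈ S.neighborhood S.Dns i, (1 + S.flawWeight lam j)) *
      (2 : ℝ) ^ (-(S.DeltaAt i : ℝ)) ≤ 1 := by
    rw [Real.rpow_neg two_pos.le, ← div_eq_mul_inv, Real.rpow_natCast]
    exact div_le_one_of_le₀ (hS.prod_one_add_le_pow _) (by positivity)
  have hpos : ∀ G : Finset (Fin m), 0 ≤ ∏ j ∈ G, (1 + S.flawWeight lam j) := fun G =>
    prod_nonneg fun j _ => by linarith [flawWeight_nonneg (S := S) (lam := lam) j]
  have e1 : S.prWeight lam i * (S.congestion S.rhoPr i *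
        ∏ j ∈ S.neighborhood S.Dpr i, (1 + S.flawWeight lam j)) ≤
      (1 - S.p) * S.flawWeight lam i := by
    calc _ = (1 - S.p) * S.flawWeight lam i *
          (((S.congestion S.rhoPr i : ℝ) * (2 : ℝ) ^ (-S.bPr i)) *
          ((∏ j ∈ S.neighborhood S.Dpr i, (1 + S.flawWeight lam j)) / 2)) := by
          rw [prWeight]; ring
      _ ≤ (1 - S.p) * S.flawWeight lam i * 1 := by
          refine mul_le_mul_of_nonneg_left ?_ (mul_nonneg hp' hT)
          exact mul_le_one₀ h1 (div_nonneg (hpos _) two_pos.le) (by linarith)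
      _ = _ := mul_one _
  have e2 : S.nsWeight lam i * (S.congestion S.rhoNs i *
        ∏ j ∈ S.neighborhood S.Dns i, (1 + S.flawWeight lam j)) ≤ S.p * S.flawWeight lam i := by
    calc _ = S.p * S.flawWeight lam i *
          (((S.congestion S.rhoNs i : ℝ) * (2 : ℝ) ^ (-S.bNs i)) *
          ((∏ j ∈ S.neighborhood S.Dns i, (1 + S.flawWeight lam j)) *
            (2 : ℝ) ^ (-(S.DeltaAt i : ℝ)))) := by
          rw [nsWeight]; ring
      _ ≤ S.p * S.flawWeight lam i * 1 := by
          refine mul_le_mul_of_nonneg_left ?_ (mul_nonneg hp hT)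
          exact mul_le_one₀ h2 (mul_nonneg (hpos _) (by positivity)) h4
      _ = _ := mul_one _
  linarith

lemma Amenable.sum_walks_le (hS : S.Amenable lam) (n : ℕ) (σ : Ω) :
    ∑ l ∈ walks n σ, listWeight (S.stepWeight lam) l ≤ Fintype.card Ω * 2 ^ m := by
  have hκ : ∀ i σ τ, 0 ≤ S.prWeight lam i * (if 0 < S.rhoPr σ τ then 1 else 0) +
      S.nsWeight lam i * (if 0 < S.rhoNs σ τ then 1 else 0) := fun i σ τ => by
    have := prWeight_nonneg (S := S) (lam := lam) i
    have := nsWeight_nonneg (S := S) (lam := lam) i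
    split_ifs <;> simp <;> linarith
  have hW := S.sum_walkMass_le (a := S.prWeight lam) (b := S.nsWeight lam)
    (T := S.flawWeight lam) prWeight_nonneg nsWeight_nonneg flawWeight_nonneg
    hS.sum_stepWeights_le n
  calc _ ≤ _ := S.sum_listWeight_le hκ n σ
    _ ≤ ∑ E, ∑ σ, S.walkMass (fun i σ τ => S.prWeight lam i * (if 0 < S.rhoPr σ τ then 1 else 0) +
      S.nsWeight lam i * (if 0 < S.rhoNs σ τ then 1 else 0)) n σ E :=
        sum_le_sum fun E _ => single_le_sum
          (fun σ _ => S.walkMass_nonneg hκ n σ E) (mem_univ σ)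
    _ ≤ ∑ E : Finset (Fin m), (Fintype.card Ω : ℝ) * ∏ i ∈ E, S.flawWeight lam i :=
        sum_le_sum fun E _ => hW E
    -- Summing the products over all pending sets expands ∏ (1 + T i), and each factor is at most 2.
    _ = Fintype.card Ω * ∏ i, (1 + S.flawWeight lam i) := by
        rw [← mul_sum, prod_one_add, powerset_univ]
    _ ≤ _ := by
        refine mul_le_mul_of_nonneg_left ?_ (Nat.cast_nonneg _)
        simpa using hS.prod_one_add_le_pow univ

/-- Makes step costs nonnegative, so that charging additional steps only enlarges the bound. -/
lemma Amenable.stepWeight_le_one (hS : S.Amenable lam) {σ : Ω} (h : S.Flawed σ) (τ : Ω) :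
    S.stepWeight lam σ τ ≤ 1 := by
  obtain ⟨i, hi⟩ := h.exists_addressed
  rw [stepWeight_eq hi]
  have hT := flawWeight_nonneg (S := S) (lam := lam) i
  have hT' := hS.flawWeight_le i
  have h1 : S.prWeight lam i ≤ 1 - S.p := by
    refine mul_le_of_le_one_right (sub_nonneg.2 S.p_mem.2) (mul_le_one₀ ?_ (by linarith)
      (by linarith))
    exact Real.rpow_le_one_of_one_le_of_nonpos one_le_two (neg_nonpos.2 (S.bPr_nonneg i))
  have h2 : S.nsWeight lam i ≤ S.p := by
    refine mul_le_of_le_one_right S.p_mem.1 (mul_le_one₀ ?_ (by positivity)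
      (mul_le_one₀ (by linarith) (by positivity) ?_))
    · exact Real.rpow_le_one_of_one_le_of_nonpos one_le_two (neg_nonpos.2 (S.bNs_nonneg i))
    · exact Real.rpow_le_one_of_one_le_of_nonpos one_le_two (neg_nonpos.2 (Nat.cast_nonneg _))
  have h3 := prWeight_nonneg (S := S) (lam := lam) i
  have h4 := nsWeight_nonneg (S := S) (lam := lam) i
  split_ifs <;> linarith

lemma stepWeight_pos {σ τ : Ω} (h : S.Flawed σ) (hρ : 0 < S.rho σ τ) :
    0 < S.stepWeight lam σ τ := by
  obtain ⟨i, hi⟩ := h.exists_addressed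
  rw [stepWeight_eq hi]
  have hT := flawWeight_pos (S := S) (lam := lam) ⟨σ, hi⟩
  have hp := S.p_mem.1
  have hp' := sub_nonneg.2 S.p_mem.2
  have h3 := prWeight_nonneg (S := S) (lam := lam) i
  have h4 := nsWeight_nonneg (S := S) (lam := lam) i
  have hr1 := (S.rhoPr_mem σ).1 τ
  have hr2 := (S.rhoNs_mem σ).1 τ
  have hor : 0 < (1 - S.p) * S.rhoPr σ τ ∨ 0 < S.p * S.rhoNs σ τ := by
    by_contra! hcon
    rw [rho] at hρ
    linarith
  rcases hor with h | h
  · have hr := pos_of_mul_pos_right h hp'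
    have hq := pos_of_mul_pos_left h hr1
    have : 0 < S.prWeight lam i := by rw [prWeight]; positivity
    rw [if_pos hr]
    split_ifs <;> linarith
  · have hr := pos_of_mul_pos_right h hp
    have hq := pos_of_mul_pos_left h hr2
    have : 0 < S.nsWeight lam i := by rw [nsWeight]; positivity
    rw [if_pos hr]
    split_ifs <;> linarith

/-- In expectation, the cost of encoding a step is at most a `λ`-fraction of its entropy. -/
lemma Amenable.sum_rho_mul_cost_le (hS : S.Amenable lam) {σ : Ω} (h : S.Flawed σ) :
    ∑ τ, S.rho σ τ * (-Real.logb 2 (S.stepWeight lam σ τ) + lam * Real.logb 2 (S.rho σ τ)) ≤ 0 := by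
  obtain ⟨i, hi⟩ := h.exists_addressed
  have hex : ∃ σ, S.Addressed σ i := ⟨σ, hi⟩
  have hT := flawWeight_pos (S := S) (lam := lam) hex
  have hp := S.p_mem.1
  have hp' := sub_nonneg.2 S.p_mem.2
  have h3 := prWeight_nonneg (S := S) (lam := lam) i
  have h4 := nsWeight_nonneg (S := S) (lam := lam) i
  -- The weight of a transition dominates each of its principal and noise parts, so each part of ρ
  -- may be charged its own weight, even when both matrices allow the arc.
  have hpr : ∀ τ, (1 - S.p) * S.rhoPr σ τ * -Real.logb 2 (S.stepWeight lam σ τ) ≤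
      (1 - S.p) * S.rhoPr σ τ * -Real.logb 2 (S.prWeight lam i) := by
    intro τ
    rcases (mul_nonneg hp' ((S.rhoPr_mem σ).1 τ)).eq_or_lt with h0 | h0
    · rw [← h0, zero_mul, zero_mul]
    · have hr := pos_of_mul_pos_right h0 hp'
      have hq := pos_of_mul_pos_left h0 ((S.rhoPr_mem σ).1 τ)
      refine mul_le_mul_of_nonneg_left (neg_le_neg ?_) h0.le
      refine Real.logb_le_logb_of_le one_lt_two (by rw [prWeight]; positivity) ?_
      rw [stepWeight_eq hi, if_pos hr]
      split_ifs <;> linarith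
  have hns : ∀ τ, S.p * S.rhoNs σ τ * -Real.logb 2 (S.stepWeight lam σ τ) ≤
      S.p * S.rhoNs σ τ * -Real.logb 2 (S.nsWeight lam i) := by
    intro τ
    rcases (mul_nonneg hp ((S.rhoNs_mem σ).1 τ)).eq_or_lt with h0 | h0
    · rw [← h0, zero_mul, zero_mul]
    · have hr := pos_of_mul_pos_right h0 hp
      have hq := pos_of_mul_pos_left h0 ((S.rhoNs_mem σ).1 τ)
      refine mul_le_mul_of_nonneg_left (neg_le_neg ?_) h0.le
      refine Real.logb_le_logb_of_le one_lt_two (by rw [nsWeight]; positivity) ?_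
      rw [stepWeight_eq hi, if_pos hr]
      split_ifs <;> linarith
  have hL := logb_flawWeight (S := S) (lam := lam) hex
  have hlpr : (1 - S.p) * -Real.logb 2 (S.prWeight lam i) = -((1 - S.p) * Real.logb 2 (1 - S.p)) +
      (1 - S.p) * (S.bPr i + 1 - Real.logb 2 (S.flawWeight lam i)) := by
    -- For p = 1 the convention log 0 = 0 makes both sides vanish; the case p = 0 below is
    -- analogous.
    rcases hp'.eq_or_lt with h0 | h0
    · rw [← h0]; simp
    · rw [prWeight, Real.logb_mul h0.ne' (by positivity), Real.logb_mul (by positivity)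
        (by positivity), Real.logb_rpow two_pos (by norm_num), Real.logb_div hT.ne' two_ne_zero,
        Real.logb_self_eq_one one_lt_two]
      ring
  have hlns : S.p * -Real.logb 2 (S.nsWeight lam i) = -(S.p * Real.logb 2 S.p) +
      S.p * (S.bNs i + S.DeltaAt i - Real.logb 2 (S.flawWeight lam i)) := by
    rcases hp.eq_or_lt with h0 | h0
    · rw [← h0]; simp
    · rw [nsWeight, Real.logb_mul h0.ne' (by positivity), Real.logb_mul (by positivity)
        (by positivity), Real.logb_rpow two_pos (by norm_num), Real.logb_mul hT.ne'
        (by positivity), Real.logb_rpow two_pos (by norm_num)]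
      ring
  have hcost : ∑ τ, S.rho σ τ * -Real.logb 2 (S.stepWeight lam σ τ) ≤ lam * S.potential i := by
    calc _ ≤ ∑ τ, ((1 - S.p) * S.rhoPr σ τ * -Real.logb 2 (S.prWeight lam i) +
          S.p * S.rhoNs σ τ * -Real.logb 2 (S.nsWeight lam i)) := by
          refine sum_le_sum fun τ _ => ?_
          rw [rho, add_mul]
          exact add_le_add (hpr τ) (hns τ)
      _ = (1 - S.p) * -Real.logb 2 (S.prWeight lam i) +
          S.p * -Real.logb 2 (S.nsWeight lam i) := by
          rw [sum_add_distrib, ← sum_mul, ← sum_mul, ← mul_sum, ← mul_sum, (S.rhoPr_mem σ).2,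
            (S.rhoNs_mem σ).2, mul_one, mul_one]
      _ ≤ _ := by
          -- The two logarithms add up to h(p), which cancels against T; the claim reduces to p
          -- (b_ns + Δ_i - 1) - p b_pr ≤ q_i, with b_ns and b_pr those of the flaw i.
          rw [hlpr, hlns, hL]
          have hq := S.le_q i
          have hb := mul_nonneg hp (S.bPr_nonneg i)
          have hh : binEntropyBits S.p =
            -(S.p * Real.logb 2 S.p) - (1 - S.p) * Real.logb 2 (1 - S.p) := by
            rw [binEntropyBits]; ring
          generalize Real.logb 2 S.p = u at *
          generalize Real.logb 2 (1 - S.p) = v at *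
          nlinarith
  have hent : lam * S.potential i ≤ lam * finEntropy (S.rho σ) :=
    mul_le_mul_of_nonneg_left (S.potential_le hi) (hS.lam_pos hex).le
  have hfin : ∑ τ, S.rho σ τ * (lam * Real.logb 2 (S.rho σ τ)) = -(lam * finEntropy (S.rho σ)) := by
    rw [finEntropy, mul_sum, ← sum_neg_distrib]
    refine sum_congr rfl fun τ _ => ?_
    rw [entropyTerm]
    ring
  simp only [mul_add, sum_add_distrib]
  rw [hfin]
  linarith

/-- The transition probabilities out of flawed states are bounded away from `1`. -/
lemma Amenable.exists_rho_le (hS : S.Amenable lam) :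
    ∃ c : ℝ, 0 ≤ c ∧ c < 1 ∧ ∀ σ τ, S.Flawed σ → S.rho σ τ ≤ c := by
  have hlt : ∀ σ τ, S.Flawed σ → S.rho σ τ < 1 := by
    intro σ τ h
    refine (S.rho_le_one σ τ).lt_of_ne fun h1 => ?_
    obtain ⟨i, hi⟩ := h.exists_addressed
    have hpos := (hS.potential_pos ⟨σ, hi⟩).trans_le (S.potential_le hi)
    -- A transition of probability 1 would make the entropy at σ zero.
    refine hpos.ne' (sum_eq_zero fun τ' _ => ?_)
    by_cases hτ : τ' = τ
    · rw [hτ, h1]; simp [entropyTerm]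
    · have h0 : S.rho σ τ' = 0 := by
        have hsum := S.sum_rho σ
        rw [← add_sum_erase _ _ (mem_univ τ), h1, add_eq_left,
          sum_eq_zero_iff_of_nonneg fun τ _ => S.rho_nonneg σ τ] at hsum
        exact hsum τ' (mem_erase.2 ⟨hτ, mem_univ _⟩)
      rw [h0]; simp [entropyTerm]
  -- Inserting 0 keeps the set non-empty if no state is flawed, and makes its maximum nonnegative.
  set A : Finset ℝ := insert 0 ((univ.filter fun x : Ω × Ω => S.Flawed x.1).image
    fun x => S.rho x.1 x.2) with hA
  have hmem : ∀ σ τ, S.Flawed σ → S.rho σ τ ∈ A := fun σ τ h =>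
    mem_insert_of_mem (mem_image.2 ⟨(σ, τ), mem_filter.2 ⟨mem_univ _, h⟩, rfl⟩)
  refine ⟨A.max' (insert_nonempty _ _), le_max' _ _ (mem_insert_self _ _), ?_,
    fun σ τ h => le_max' _ _ (hmem σ τ h)⟩
  rw [max'_lt_iff]
  intro y hy
  rcases mem_insert.1 hy with rfl | hy
  · exact one_pos
  · obtain ⟨x, hx, rfl⟩ := mem_image.1 hy
    exact hlt _ _ (mem_filter.1 hx).2

end Cost

/-! ### Gibbs' inequality. -/

section Gibbs

/-- Gibbs' inequality against a subprobability vector. -/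
lemma sum_entropyTerm_le {ι : Type*} (s : Finset ι) {q y : ι → ℝ} (hq : ∀ i ∈ s, 0 ≤ q i)
    (hq1 : ∑ i ∈ s, q i = 1) (hy : ∀ i ∈ s, 0 ≤ y i) (hqy : ∀ i ∈ s, 0 < q i → 0 < y i)
    (hy1 : ∑ i ∈ s, y i ≤ 1) :
    ∑ i ∈ s, entropyTerm (q i) ≤ ∑ i ∈ s, q i * -Real.logb 2 (y i) := by
  have hlog : 0 < Real.log 2 := Real.log_pos one_lt_two
  have key : ∀ i ∈ s, entropyTerm (q i) - q i * -Real.logb 2 (y i) ≤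
      (y i - q i) / Real.log 2 := by
    intro i hi
    rcases (hq i hi).eq_or_lt with h0 | h0
    · rw [← h0, entropyTerm]
      simpa using div_nonneg (hy i hi) hlog.le
    · have hy0 := hqy i hi h0
      have h1 : Real.log (y i / q i) ≤ y i / q i - 1 := Real.log_le_sub_one_of_pos (by positivity)
      have h2 : entropyTerm (q i) - q i * -Real.logb 2 (y i) =
          q i * Real.log (y i / q i) / Real.log 2 := by
        rw [Real.log_div hy0.ne' h0.ne', entropyTerm, Real.logb, Real.logb]
        ring
      rw [h2]
      refine div_le_div_of_nonneg_right ?_ hlog.le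
      calc _ ≤ q i * (y i / q i - 1) := mul_le_mul_of_nonneg_left h1 h0.le
        _ = _ := by field_simp
  have hsum := sum_le_sum key
  rw [sum_sub_distrib, ← sum_div, sum_sub_distrib, hq1] at hsum
  have : (∑ i ∈ s, y i - 1) / Real.log 2 ≤ 0 :=
    div_nonpos_of_nonpos_of_nonneg (by linarith) hlog.le
  linarith

end Gibbs

/-! ### Expectations over finitely many steps of the chain. -/

section PathExpectation

variable {Ω : Type*}

/-- The sequence that follows `t` and then stays at the last entry of `t`. -/
def extendPath {n : ℕ} (t : Fin (n + 1) → Ω) (k : ℕ) : Ω := t ⟨min k n, by omega⟩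

lemma extendPath_of_le {n : ℕ} (t : Fin (n + 1) → Ω) {k : ℕ} (hk : k ≤ n) :
    extendPath t k = t ⟨k, by omega⟩ := by
  simp only [extendPath, min_eq_left hk]

lemma extendPath_snoc_of_le {n : ℕ} (t : Fin (n + 1) → Ω) (τ : Ω) {k : ℕ} (hk : k ≤ n) :
    extendPath (Fin.snoc (α := fun _ => Ω) t τ) k = extendPath t k := by
  rw [extendPath_of_le _ hk, extendPath_of_le _ (by omega)]
  exact Fin.snoc_castSucc (α := fun _ => Ω) (i := ⟨k, by omega⟩) ..

lemma extendPath_snoc_last {n : ℕ} (t : Fin (n + 1) → Ω) (τ : Ω) :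
    extendPath (Fin.snoc (α := fun _ => Ω) t τ) (n + 1) = τ := by
  rw [extendPath_of_le _ le_rfl]
  exact Fin.snoc_last (α := fun _ => Ω) ..

variable [Fintype Ω] {m : ℕ} (S : NoisySystem Ω m)

lemma pathProb_congr {s s' : ℕ → Ω} {n : ℕ} (h : ∀ k ≤ n, s k = s' k) :
    S.pathProb s n = S.pathProb s' n := by
  refine prod_congr rfl fun k hk => ?_
  rw [mem_range] at hk
  rw [h k hk.le, h (k + 1) hk]

lemma pathProb_nonneg (s : ℕ → Ω) (n : ℕ) : 0 ≤ S.pathProb s n :=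
  prod_nonneg fun _ _ => S.rho_nonneg _ _

lemma pathProb_succ (s : ℕ → Ω) (n : ℕ) :
    S.pathProb s (n + 1) = S.pathProb s n * S.rho (s n) (s (n + 1)) :=
  prod_range_succ _ _

/-- The probability that the first `n` steps of the chain started at `σ₁` follow `s`. -/
def startProb (σ₁ : Ω) (s : ℕ → Ω) (n : ℕ) : ℝ := if s 0 = σ₁ then S.pathProb s n else 0

lemma startProb_nonneg (σ₁ : Ω) (s : ℕ → Ω) (n : ℕ) : 0 ≤ S.startProb σ₁ s n := by
  rw [startProb]
  split_ifs
  · exact S.pathProb_nonneg _ _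
  · exact le_rfl

/-- The expectation of a function of the first `n` steps of the chain started at `σ₁`. -/
def pathExp (σ₁ : Ω) (n : ℕ) (G : (ℕ → Ω) → ℝ) : ℝ :=
  ∑ t : Fin (n + 1) → Ω, S.startProb σ₁ (extendPath t) n * G (extendPath t)

lemma pathExp_mono {σ₁ : Ω} {n : ℕ} {G G' : (ℕ → Ω) → ℝ}
    (h : ∀ s, s 0 = σ₁ → 0 < S.pathProb s n → G s ≤ G' s) :
    S.pathExp σ₁ n G ≤ S.pathExp σ₁ n G' := by
  refine sum_le_sum fun t _ => ?_
  rw [startProb]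
  split_ifs with h0
  · rcases (S.pathProb_nonneg (extendPath t) n).eq_or_lt with h1 | h1
    · simp [← h1]
    · exact mul_le_mul_of_nonneg_left (h _ h0 h1) h1.le
  · simp

lemma pathExp_add (σ₁ : Ω) (n : ℕ) (G G' : (ℕ → Ω) → ℝ) :
    S.pathExp σ₁ n (fun s => G s + G' s) = S.pathExp σ₁ n G + S.pathExp σ₁ n G' := by
  simp only [pathExp, mul_add, sum_add_distrib]

lemma pathExp_sum {ι : Type*} (u : Finset ι) (σ₁ : Ω) (n : ℕ) (G : ι → (ℕ → Ω) → ℝ) :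
    S.pathExp σ₁ n (fun s => ∑ i ∈ u, G i s) = ∑ i ∈ u, S.pathExp σ₁ n (G i) := by
  simp only [pathExp, mul_sum]
  exact sum_comm

lemma pathExp_mul_const (σ₁ : Ω) (n : ℕ) (G : (ℕ → Ω) → ℝ) (a : ℝ) :
    S.pathExp σ₁ n (fun s => G s * a) = S.pathExp σ₁ n G * a := by
  simp only [pathExp, sum_mul, mul_assoc]

/-- The tower property, conditioning on the first n steps. -/
lemma pathExp_succ (σ₁ : Ω) (n : ℕ) {G : (ℕ → Ω) → ℝ} (hG : DependsOn G (Set.Iic (n + 1))) :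
    S.pathExp σ₁ (n + 1) G =
      S.pathExp σ₁ n fun s => ∑ τ, S.rho (s n) τ * G (Function.update s (n + 1) τ) := by
  rw [pathExp, ← (Fin.snocEquiv fun _ : Fin (n + 2) => Ω).sum_comp, Fintype.sum_prod_type,
    sum_comm, pathExp]
  refine sum_congr rfl fun t _ => ?_
  rw [mul_sum]
  refine sum_congr rfl fun τ _ => ?_
  have hle : ∀ k ≤ n, extendPath (Fin.snocEquiv (fun _ : Fin (n + 2) => Ω) (τ, t)) k =
      extendPath t k := fun k hk => extendPath_snoc_of_le t τ hk
  have hlast : extendPath (Fin.snocEquiv (fun _ : Fin (n + 2) => Ω) (τ, t)) (n + 1) = τ :=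
    extendPath_snoc_last t τ
  have hGt : G (extendPath (Fin.snocEquiv (fun _ : Fin (n + 2) => Ω) (τ, t))) =
      G (Function.update (extendPath t) (n + 1) τ) := by
    refine hG fun k hk => ?_
    rcases (Set.mem_Iic.1 hk).eq_or_lt with rfl | hk
    · rw [hlast, Function.update_self]
    · rw [hle k (by omega), Function.update_of_ne hk.ne]
  rw [hGt, startProb, startProb, hle 0 (Nat.zero_le _), pathProb_succ, S.pathProb_congr hle,
    hlast, hle n le_rfl]
  split_ifs <;> ring

lemma pathExp_succ_eq (σ₁ : Ω) (n : ℕ) {G : (ℕ → Ω) → ℝ} (hG : DependsOn G (Set.Iic n)) :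
    S.pathExp σ₁ (n + 1) G = S.pathExp σ₁ n G := by
  rw [S.pathExp_succ σ₁ n (hG.mono (Set.Iic_subset_Iic.2 n.le_succ))]
  congr 1
  funext s
  rw [sum_congr rfl (g := fun τ => S.rho (s n) τ * G s), ← sum_mul, S.sum_rho, one_mul]
  intro τ _
  congr 1
  refine hG fun k hk => Function.update_of_ne ?_ _ _
  have := Set.mem_Iic.1 hk
  omega

lemma pathExp_eq_of_le (σ₁ : Ω) {n N : ℕ} (hN : n ≤ N) {G : (ℕ → Ω) → ℝ}
    (hG : DependsOn G (Set.Iic n)) : S.pathExp σ₁ N G = S.pathExp σ₁ n G := by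
  induction N, hN using Nat.le_induction with
  | base => rfl
  | succ N hN ih =>
    rw [S.pathExp_succ_eq σ₁ N (hG.mono (Set.Iic_subset_Iic.2 hN)), ih]

/-- A step whose conditional expectation is nonpositive on the event where it is counted. -/
lemma pathExp_step_nonpos (σ₁ : Ω) {k N : ℕ} (hk : k < N) {A : (ℕ → Ω) → Prop}
    (hA : DependsOn A (Set.Iic k)) {d : Ω → Ω → ℝ}
    (hd : ∀ s, A s → ∑ τ, S.rho (s k) τ * d (s k) τ ≤ 0) :
    S.pathExp σ₁ N (fun s => if A s then d (s k) (s (k + 1)) else 0) ≤ 0 := by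
  have hdep : DependsOn (fun s : ℕ → Ω => if A s then d (s k) (s (k + 1)) else 0)
      (Set.Iic (k + 1)) := by
    intro s s' h
    have h1 : A s = A s' := hA fun j hj => h j (Set.Iic_subset_Iic.2 k.le_succ hj)
    simp only [h1, h k (Set.mem_Iic.2 k.le_succ), h (k + 1) (Set.mem_Iic.2 le_rfl)]
  rw [S.pathExp_eq_of_le σ₁ hk hdep, S.pathExp_succ σ₁ k hdep]
  refine sum_nonpos fun t _ => mul_nonpos_of_nonneg_of_nonpos (S.startProb_nonneg _ _ _) ?_
  set s := extendPath t
  have hAu : ∀ τ, A (Function.update s (k + 1) τ) = A s := fun τ =>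
    hA fun j hj => Function.update_of_ne (by have := Set.mem_Iic.1 hj; omega) _ _
  simp only [hAu, Function.update_self, Function.update_of_ne (Nat.lt_succ_self k).ne]
  by_cases h : A s
  · simpa only [if_pos h] using hd s h
  · simp [if_neg h]

variable {W : Type*} [MeasurableSpace W] {μ : Measure W} [IsProbabilityMeasure μ]

/-- The event is a finite disjoint union of cylinders, and `law` prescribes the measure of each. -/
lemma IsTrajectory.measureReal_eq {S : NoisySystem Ω m} {σ₁ : Ω} {X : ℕ → W → Ω}
    (hX : S.IsTrajectory μ σ₁ X) {α : Type*} {G : (ℕ → Ω) → α} {n : ℕ}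
    (hG : DependsOn G (Set.Iic n)) (v : α) :
    μ.real {ω | G (fun k => X k ω) = v} =
      S.pathExp σ₁ n fun s => if G s = v then 1 else 0 := by
  have hset : {ω | G (fun k => X k ω) = v} =
      ⋃ t ∈ univ.filter (fun t : Fin (n + 1) → Ω => G (extendPath t) = v),
        {ω | ∀ k ≤ n, X k ω = extendPath t k} := by
    ext ω
    simp only [Set.mem_ofPred_eq, Set.mem_iUnion, mem_filter, mem_univ, true_and, exists_prop]
    constructor
    · intro h
      have ht : ∀ k ≤ n, X k ω = extendPath (fun i : Fin (n + 1) => X i ω) k := fun k hk => by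
        rw [extendPath_of_le _ hk]
      exact ⟨fun i => X i ω, by rw [← h]; exact hG fun k hk => (ht k hk).symm, ht⟩
    · rintro ⟨t, h, ht⟩
      rw [← h]
      exact hG fun k hk => ht k hk
  rw [hset, measureReal_biUnion_finset]
  · rw [pathExp, sum_filter]
    refine sum_congr rfl fun t _ => ?_
    split_ifs
    · rw [hX.law, startProb, mul_one]
    · rw [mul_zero]
  · intro t _ t' _ hne
    refine Set.disjoint_left.2 fun ω h h' => hne ?_
    funext i
    have h1 := h i (by omega)
    have h2 := h' i (by omega)
    rw [extendPath_of_le _ (by omega)] at h1 h2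
    exact h1.symm.trans h2
  · intro t _
    have : {ω | ∀ k ≤ n, X k ω = extendPath t k} =
        ⋂ k, ⋂ (_ : k ≤ n), {ω | X k ω = extendPath t k} := by
      ext ω; simp
    rw [this]
    exact MeasurableSet.iInter fun k => MeasurableSet.iInter fun _ => hX.measurableSet_eq _ _

end PathExpectation

/-! ### The bad prefix has bounded length, and its steps reveal bounded information. -/

section BadPrefix

variable {Ω : Type*} [Fintype Ω] {m : ℕ} (S : NoisySystem Ω m) {x : ℝ}

lemma inTruncation_congr {s s' : ℕ → Ω} {k : ℕ} (h : ∀ j < k, s j = s' j)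
    (hs : S.InTruncation x s k) : S.InTruncation x s' k := fun n hn => by
  rw [← S.pathProb_congr fun j hj => h j (hj.trans_lt hn)]
  exact hs n hn

lemma pathProb_le_pow {c : ℝ} (hc : ∀ σ τ, S.Flawed σ → S.rho σ τ ≤ c) {s : ℕ → Ω} {n : ℕ}
    (h : ∀ k < n, S.Flawed (s k)) : S.pathProb s n ≤ c ^ n := by
  calc _ ≤ ∏ _k ∈ range n, c :=
        prod_le_prod (fun _ _ => S.rho_nonneg _ _) fun k hk => hc _ _ (h k (mem_range.1 hk))
    _ = _ := by simp

lemma le_of_mem_badLength {N : ℕ}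
    (hN : ∀ s : ℕ → Ω, (∀ k < N, S.Flawed (s k)) → S.pathProb s N ≤ (2 : ℝ) ^ (-x))
    {s : ℕ → Ω} {l : ℕ} (hl : ∀ k < l, S.Flawed (s k) ∧ S.InTruncation x s k) : l ≤ N + 1 := by
  by_contra! h
  -- Were l ≥ N + 2, state N + 1 would lie in the truncated tree, although its proper prefix ending
  -- at state N already has probability at most 2^(-x).
  exact ((hl (N + 1) h).2 N N.lt_succ_self).not_ge
    (hN s fun k hk => (hl k (by omega)).1)

lemma badLength_mem {N : ℕ}
    (hN : ∀ s : ℕ → Ω, (∀ k < N, S.Flawed (s k)) → S.pathProb s N ≤ (2 : ℝ) ^ (-x))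
    (s : ℕ → Ω) : ∀ k < S.badLength x s, S.Flawed (s k) ∧ S.InTruncation x s k :=
  Nat.sSup_mem (s := {l | ∀ k < l, S.Flawed (s k) ∧ S.InTruncation x s k})
    ⟨0, fun k hk => absurd hk (Nat.not_lt_zero k)⟩
    ⟨N + 1, fun _ hl => S.le_of_mem_badLength hN hl⟩

lemma badLength_congr {N : ℕ}
    (hN : ∀ s : ℕ → Ω, (∀ k < N, S.Flawed (s k)) → S.pathProb s N ≤ (2 : ℝ) ^ (-x))
    {s s' : ℕ → Ω} (h : ∀ k ≤ N, s k = s' k) : S.badLength x s = S.badLength x s' := by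
  have key : ∀ s s' : ℕ → Ω, (∀ k ≤ N, s k = s' k) →
      ∀ l, (∀ k < l, S.Flawed (s k) ∧ S.InTruncation x s k) →
        ∀ k < l, S.Flawed (s' k) ∧ S.InTruncation x s' k := by
    intro s s' h l hl k hk
    have hlN := S.le_of_mem_badLength hN hl
    refine ⟨?_, S.inTruncation_congr (fun j hj => h j (by omega)) (hl k hk).2⟩
    rw [← h k (by omega)]
    exact (hl k hk).1
  rw [badLength, badLength]
  congr 1
  ext l
  exact ⟨key s s' h l, key s' s (fun k hk => (h k hk).symm) l⟩

lemma dependsOn_badPrefix {N : ℕ}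
    (hN : ∀ s : ℕ → Ω, (∀ k < N, S.Flawed (s k)) → S.pathProb s N ≤ (2 : ℝ) ^ (-x)) :
    DependsOn (S.badPrefix x) (Set.Iic N) := by
  intro s s' h
  rw [badPrefix, badPrefix, S.badLength_congr hN fun k hk => h k hk]
  refine List.map_congr_left fun k hk => h k ?_
  have := S.le_of_mem_badLength hN (S.badLength_mem hN s')
  rw [List.mem_range] at hk
  rw [Set.mem_Iic]
  omega

lemma badLength_eq_zero {s : ℕ → Ω} (h : ¬ S.Flawed (s 0)) : S.badLength x s = 0 := by
  have : {l | ∀ k < l, S.Flawed (s k) ∧ S.InTruncation x s k} = {0} := by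
    ext l
    simp only [Set.mem_ofPred_eq, Set.mem_singleton_iff]
    constructor
    · intro hl
      by_contra h0
      exact h (hl 0 (by omega)).1
    · rintro rfl k hk
      exact absurd hk (Nat.not_lt_zero k)
  rw [badLength, this, csSup_singleton]

lemma one_le_badLength {N : ℕ}
    (hN : ∀ s : ℕ → Ω, (∀ k < N, S.Flawed (s k)) → S.pathProb s N ≤ (2 : ℝ) ^ (-x))
    {s : ℕ → Ω} (h : S.Flawed (s 0)) : 1 ≤ S.badLength x s := by
  refine le_csSup ⟨N + 1, fun _ hl => S.le_of_mem_badLength hN hl⟩ ?_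
  intro k hk
  obtain rfl : k = 0 := by omega
  exact ⟨h, fun n hn => absurd hn (Nat.not_lt_zero n)⟩

/-- The `k`-th step of the trajectory leaves a state of the bad prefix that is not a leaf of the
truncated process tree. -/
def ActiveStep (x : ℝ) (k : ℕ) (s : ℕ → Ω) : Prop :=
  (∀ j ≤ k, S.Flawed (s j)) ∧ S.InTruncation x s (k + 1)

lemma dependsOn_activeStep (k : ℕ) : DependsOn (S.ActiveStep x k) (Set.Iic k) := by
  have key : ∀ s s' : ℕ → Ω, (∀ i ∈ Set.Iic k, s i = s' i) →
      S.ActiveStep x k s → S.ActiveStep x k s' := fun s s' h hs =>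
    ⟨fun j hj => h j hj ▸ hs.1 j hj,
      S.inTruncation_congr (fun j hj => h j (Set.mem_Iic.2 (by omega))) hs.2⟩
  exact fun s s' h => propext ⟨key s s' h, key s' s fun i hi => (h i hi).symm⟩

/-- The information revealed by the active steps is at most `x + B`. -/
lemma sum_active_information_le {B : ℝ}
    (hB : ∀ σ τ, 0 < S.rho σ τ → (2 : ℝ) ^ (-B) < S.rho σ τ) (hxB : 0 ≤ x + B) {s : ℕ → Ω}
    {N : ℕ} (hs : 0 < S.pathProb s N) :
    ∑ k ∈ range N, (if S.ActiveStep x k s then -Real.logb 2 (S.rho (s k) (s (k + 1))) else 0) ≤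
      x + B := by
  have hpos : ∀ k < N, 0 < S.rho (s k) (s (k + 1)) := fun k hk =>
    (S.rho_nonneg _ _).lt_of_ne fun h0 => hs.ne' (prod_eq_zero (mem_range.2 hk) h0.symm)
  -- Active steps form an initial segment. While they last, the sum telescopes to -log₂ of the path
  -- probability, which is below x before each active step; the last one adds less than B, and
  -- afterwards the sum is frozen.
  suffices h : ∀ n ≤ N,
      (∑ k ∈ range n, (if S.ActiveStep x k s then -Real.logb 2 (S.rho (s k) (s (k + 1))) else 0) ≤
        x + B) ∧ (S.ActiveStep x n s → ∑ k ∈ range n,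
        (if S.ActiveStep x k s then -Real.logb 2 (S.rho (s k) (s (k + 1))) else 0) =
          -Real.logb 2 (S.pathProb s n)) from (h N le_rfl).1
  intro n
  induction n with
  | zero => intro _; simpa [pathProb] using hxB
  | succ n ih =>
    intro hn
    obtain ⟨ih1, ih2⟩ := ih (by omega)
    rw [sum_range_succ]
    by_cases h : S.ActiveStep x n s
    · have hp : (2 : ℝ) ^ (-x) < S.pathProb s n := h.2 n n.lt_succ_self
      have hp0 : 0 < S.pathProb s n := lt_trans (by positivity) hp
      have hr0 := hpos n (by omega)
      have h1 : -x < Real.logb 2 (S.pathProb s n) :=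
        (Real.lt_logb_iff_rpow_lt one_lt_two hp0).2 hp
      have h2 : -B < Real.logb 2 (S.rho (s n) (s (n + 1))) :=
        (Real.lt_logb_iff_rpow_lt one_lt_two hr0).2 (hB _ _ hr0)
      rw [if_pos h, ih2 h, pathProb_succ, Real.logb_mul hp0.ne' hr0.ne']
      exact ⟨by linarith, fun _ => by ring⟩
    · rw [if_neg h, add_zero]
      refine ⟨ih1, fun h' => absurd ⟨fun j hj => h'.1 j (by omega), fun j hj => ?_⟩ h⟩
      exact h'.2 j (by omega)

end BadPrefix

/-! ### The code length of the bad prefix, charged to active steps. -/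

section Main

variable {Ω : Type*} [Fintype Ω] {m : ℕ} {S : NoisySystem Ω m} {x lam : ℝ}

/-- The cost of encoding the bad prefix is the cost of encoding its steps. -/
lemma Amenable.neg_logb_listWeight_le (hS : S.Amenable lam) {N : ℕ}
    (hN : ∀ s : ℕ → Ω, (∀ k < N, S.Flawed (s k)) → S.pathProb s N ≤ (2 : ℝ) ^ (-x))
    {s : ℕ → Ω} (hs : 0 < S.pathProb s N) (h0 : S.Flawed (s 0)) :
    0 < listWeight (S.stepWeight lam) (S.badPrefix x s) ∧
    -Real.logb 2 (listWeight (S.stepWeight lam) (S.badPrefix x s)) ≤ ∑ k ∈ range N,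
      (if S.ActiveStep x k s then -Real.logb 2 (S.stepWeight lam (s k) (s (k + 1))) else 0) := by
  have hpos : ∀ k < N, 0 < S.rho (s k) (s (k + 1)) := fun k hk =>
    (S.rho_nonneg _ _).lt_of_ne fun h0 => hs.ne' (prod_eq_zero (mem_range.2 hk) h0.symm)
  have hmem := S.badLength_mem hN s
  have hle := S.le_of_mem_badLength hN hmem
  obtain ⟨n, hn⟩ : ∃ n, S.badLength x s = n + 1 :=
    ⟨_, (Nat.sub_add_cancel (S.one_le_badLength hN h0)).symm⟩
  rw [hn] at hmem hle
  have hw : ∀ k ∈ range n, 0 < S.stepWeight lam (s k) (s (k + 1)) := fun k hk => by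
    rw [mem_range] at hk
    exact stepWeight_pos (hmem k (by omega)).1 (hpos k (by omega))
  rw [badPrefix, hn, listWeight_map_range]
  refine ⟨prod_pos hw, ?_⟩
  rw [Real.logb_prod _ _ fun k hk => (hw k hk).ne', ← sum_neg_distrib]
  have hact : ∀ k ∈ range n, S.ActiveStep x k s := fun k hk => by
    rw [mem_range] at hk
    exact ⟨fun j hj => (hmem j (by omega)).1, (hmem (k + 1) (by omega)).2⟩
  calc _ = ∑ k ∈ range n, (if S.ActiveStep x k s then
        -Real.logb 2 (S.stepWeight lam (s k) (s (k + 1))) else 0) :=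
        sum_congr rfl fun k hk => (if_pos (hact k hk)).symm
    _ ≤ _ := by
        -- One more step may be active: the one from the last state of the bad prefix to a flawless
        -- state. Its cost is nonnegative.
        refine sum_le_sum_of_subset_of_nonneg (range_subset_range.2 (by omega)) fun k _ _ => ?_
        split_ifs with h
        · exact neg_nonneg.2 (Real.logb_nonpos one_lt_two (stepWeight_nonneg _ _)
            (hS.stepWeight_le_one (h.1 k le_rfl) _))
        · exact le_rfl

lemma badPrefix_mem_walks {N : ℕ}
    (hN : ∀ s : ℕ → Ω, (∀ k < N, S.Flawed (s k)) → S.pathProb s N ≤ (2 : ℝ) ^ (-x))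
    {s : ℕ → Ω} (h0 : S.Flawed (s 0)) : S.badPrefix x s ∈ walks N (s 0) := by
  have hle := S.le_of_mem_badLength hN (S.badLength_mem hN s)
  obtain ⟨n, hn⟩ : ∃ n, S.badLength x s = n + 1 :=
    ⟨_, (Nat.sub_add_cancel (S.one_le_badLength hN h0)).symm⟩
  rw [badPrefix, hn, List.range_succ_eq_map, List.map_cons]
  exact mem_walks _ _ _ (by simp; omega)

end Main

/-! ### From expected code length to entropy. -/

section EntropyBound

variable {Ω : Type*} [Fintype Ω] {m : ℕ} {S : NoisySystem Ω m} {x lam : ℝ}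

lemma Amenable.exists_horizon (hS : S.Amenable lam) (x : ℝ) :
    ∃ N, ∀ s : ℕ → Ω, (∀ k < N, S.Flawed (s k)) → S.pathProb s N ≤ (2 : ℝ) ^ (-x) := by
  obtain ⟨c, -, hc1, hc⟩ := hS.exists_rho_le
  obtain ⟨N, hN⟩ := exists_pow_lt_of_lt_one (show (0 : ℝ) < (2 : ℝ) ^ (-x) by positivity) hc1
  exact ⟨N, fun s hs => (S.pathProb_le_pow hc hs).trans hN.le⟩

lemma pos_of_two_rpow_neg_lt_rho [Nonempty Ω] {B : ℝ}
    (hB : ∀ σ τ, 0 < S.rho σ τ → (2 : ℝ) ^ (-B) < S.rho σ τ) : 0 < B := by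
  obtain ⟨σ⟩ := ‹Nonempty Ω›
  obtain ⟨τ, hτ⟩ : ∃ τ, 0 < S.rho σ τ := by
    by_contra! h
    have := sum_nonpos fun τ (_ : τ ∈ univ) => h τ
    linarith [S.sum_rho σ]
  have h1 := (Real.lt_logb_iff_rpow_lt one_lt_two hτ).2 (hB σ τ hτ)
  linarith [Real.logb_nonpos one_lt_two hτ.le (S.rho_le_one σ τ)]

/-- The encoding needs only log₂|Ω| + m + λB, and each flaw contributes (Δ + 1)(Ξ + 4) ≥ 1 to `M0`.
-/
lemma logb_card_mul_two_pow_le [Nonempty Ω] {B : ℝ} :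
    Real.logb 2 (Fintype.card Ω * 2 ^ m) + lam * B ≤ S.M0 lam B := by
  have hcard : (0 : ℝ) < Fintype.card Ω := by exact_mod_cast Fintype.card_pos
  rw [M0, Real.logb_mul hcard.ne' (by positivity), Real.logb_pow,
    Real.logb_self_eq_one one_lt_two, mul_one]
  have h1 : (1 : ℝ) ≤ (S.DeltaMax + 1) * (S.Xi + 4) := by
    have h2 : (1 : ℝ) ≤ S.DeltaMax + 1 := by
      have : (0 : ℝ) ≤ S.DeltaMax := Nat.cast_nonneg _
      linarith
    exact one_le_mul_of_one_le_of_one_le h2 (by linarith [S.Xi_nonneg])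
  have := mul_le_mul_of_nonneg_left h1 (Nat.cast_nonneg (α := ℝ) m)
  linarith

/-- In expectation, the encoding of the active steps costs at most `λ (x + B)`. -/
lemma Amenable.pathExp_cost_le (hS : S.Amenable lam) (hlam : 0 < lam) {B : ℝ}
    (hB : ∀ σ τ, 0 < S.rho σ τ → (2 : ℝ) ^ (-B) < S.rho σ τ) (hxB : 0 ≤ x + B) (σ₁ : Ω) (N : ℕ)
    (C : ℝ) (hprob : S.pathExp σ₁ N (fun _ => 1) = 1) :
    S.pathExp σ₁ N (fun s => C + ∑ k ∈ range N,
      (if S.ActiveStep x k s then -Real.logb 2 (S.stepWeight lam (s k) (s (k + 1))) else 0)) ≤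
      C + lam * (x + B) := by
  -- The pathwise bound λ (x + B) on the revealed information is traded for adding λ log₂ ρ to each
  -- step cost, after which every active step has nonpositive conditional mean.
  calc _ ≤ S.pathExp σ₁ N (fun s => 1 * (C + lam * (x + B)) + ∑ k ∈ range N,
        (if S.ActiveStep x k s then -Real.logb 2 (S.stepWeight lam (s k) (s (k + 1))) +
          lam * Real.logb 2 (S.rho (s k) (s (k + 1))) else 0)) := by
        refine S.pathExp_mono fun s _ hs => ?_
        have h := mul_le_mul_of_nonneg_left (S.sum_active_information_le hB hxB hs) hlam.le
        have hsplit : ∑ k ∈ range N, (if S.ActiveStep x k s then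
            -Real.logb 2 (S.stepWeight lam (s k) (s (k + 1))) +
              lam * Real.logb 2 (S.rho (s k) (s (k + 1))) else 0) =
            ∑ k ∈ range N, (if S.ActiveStep x k s then
              -Real.logb 2 (S.stepWeight lam (s k) (s (k + 1))) else 0) -
            lam * ∑ k ∈ range N, (if S.ActiveStep x k s then
              -Real.logb 2 (S.rho (s k) (s (k + 1))) else 0) := by
          rw [mul_sum, ← sum_sub_distrib]
          refine sum_congr rfl fun k _ => ?_
          split_ifs <;> ring
        rw [hsplit]
        linarith
    _ ≤ C + lam * (x + B) + 0 := by
        rw [pathExp_add, pathExp_mul_const, pathExp_sum, hprob, one_mul]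
        refine add_le_add le_rfl (sum_nonpos fun k hk => ?_)
        exact S.pathExp_step_nonpos σ₁ (mem_range.1 hk) (S.dependsOn_activeStep k)
          (d := fun σ τ => -Real.logb 2 (S.stepWeight lam σ τ) + lam * Real.logb 2 (S.rho σ τ))
          fun s h => hS.sum_rho_mul_cost_le (h.1 k le_rfl)
    _ = _ := add_zero _

/-- Gibbs' inequality with the normalized walk weights; log₂ of the normalization K is a constant
added to the cost. -/
lemma Amenable.sum_entropyTerm_walks_le (hS : S.Amenable lam) (hlam : 0 < lam) {B : ℝ}
    (hB : ∀ σ τ, 0 < S.rho σ τ → (2 : ℝ) ^ (-B) < S.rho σ τ) (hxB : 0 ≤ x + B) {σ₁ : Ω}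
    (hσ₁ : S.Flawed σ₁) {N : ℕ}
    (hN : ∀ s : ℕ → Ω, (∀ k < N, S.Flawed (s k)) → S.pathProb s N ≤ (2 : ℝ) ^ (-x))
    (hprob : S.pathExp σ₁ N (fun _ => 1) = 1)
    (hsum : ∑ v ∈ walks N σ₁, S.pathExp σ₁ N (fun s => if S.badPrefix x s = v then 1 else 0) = 1) :
    ∑ v ∈ walks N σ₁,
        entropyTerm (S.pathExp σ₁ N (fun s => if S.badPrefix x s = v then 1 else 0)) ≤
      Real.logb 2 (Fintype.card Ω * 2 ^ m) + lam * (x + B) := by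
  have : Nonempty Ω := ⟨σ₁⟩
  have hcard : (0 : ℝ) < Fintype.card Ω := by exact_mod_cast Fintype.card_pos
  set K : ℝ := Fintype.card Ω * 2 ^ m with hK
  have hK0 : 0 < K := by positivity
  have hw := listWeight_nonneg (w := S.stepWeight lam) stepWeight_nonneg
  have hcost : ∀ s : ℕ → Ω, s 0 = σ₁ → 0 < S.pathProb s N →
      0 < listWeight (S.stepWeight lam) (S.badPrefix x s) ∧ _ := fun s h0 hs =>
    hS.neg_logb_listWeight_le hN hs (h0 ▸ hσ₁)
  refine (sum_entropyTerm_le (walks N σ₁) (y := fun v => listWeight (S.stepWeight lam) v / K)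
    ?_ hsum ?_ ?_ ?_).trans ?_
  · exact fun v _ => sum_nonneg fun t _ =>
      mul_nonneg (S.startProb_nonneg _ _ _) (by dsimp only; split_ifs <;> norm_num)
  · exact fun v _ => div_nonneg (hw v) hK0.le
  -- A value v of positive probability is the bad prefix of some path of positive probability, so
  -- all its step weights are positive.
  · intro v _ hv
    obtain ⟨t, -, ht⟩ := exists_ne_zero_of_sum_ne_zero hv.ne'
    have ht1 := left_ne_zero_of_mul ht
    rw [startProb] at ht1
    have h0 : extendPath t 0 = σ₁ := by
      by_contra h0
      exact ht1 (if_neg h0)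
    rw [if_pos h0] at ht1
    have hv : S.badPrefix x (extendPath t) = v := by
      by_contra h
      exact ht (by simp only [if_neg h, mul_zero])
    rw [← hv]
    exact div_pos (hcost _ h0 ((S.pathProb_nonneg _ _).lt_of_ne' ht1)).1 hK0
  · rw [← sum_div]
    exact div_le_one_of_le₀ (hS.sum_walks_le N σ₁) hK0.le
  · refine le_trans ?_ (hS.pathExp_cost_le hlam hB hxB σ₁ N (Real.logb 2 K) hprob)
    simp only [← pathExp_mul_const, ← pathExp_sum]
    refine S.pathExp_mono fun s h0 hs => ?_
    have hmem : S.badPrefix x s ∈ walks N σ₁ := h0 ▸ S.badPrefix_mem_walks hN (h0 ▸ hσ₁)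
    simp only [ite_mul, one_mul, zero_mul]
    rw [sum_ite_eq, if_pos hmem, Real.logb_div (hcost s h0 hs).1.ne' hK0.ne']
    linarith [(hcost s h0 hs).2]

end EntropyBound

end NoisySystem

end

/-! ### The theorem. -/

open NoisySystem in
theorem theorem2 {Ω : Type*} [Fintype Ω] {m : ℕ} (S : NoisySystem Ω m)
    (hF : ∃ i, (S.flaw i).Nonempty)
    (B : ℝ) (hB : ∀ σ τ, 0 < S.rho σ τ → (2 : ℝ) ^ (-B) < S.rho σ τ)
    (lam : ℝ) (hlam : lam < 1) (hS : S.Amenable lam)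
    {W : Type*} [MeasurableSpace W] (μ : MeasureTheory.Measure W)
    [MeasureTheory.IsProbabilityMeasure μ]
    (σ₁ : Ω) (X : ℕ → W → Ω) (hX : S.IsTrajectory μ σ₁ X)
    (x : ℝ) (hx : 0 < x) :
    Summable (fun v : List Ω =>
        entropyTerm (μ.real {ω | S.badPrefix x (fun k => X k ω) = v})) ∧
      entropyBits μ (fun ω => S.badPrefix x (fun k => X k ω)) ≤ lam * x + S.M0 lam B := by
  classical
  have : Nonempty Ω := ⟨σ₁⟩
  have hlam0 : 0 < lam := by
    obtain ⟨i, σ, hσ⟩ := hF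
    obtain ⟨j, hj⟩ := Flawed.exists_addressed (S := S) ⟨i, hσ⟩
    exact hS.lam_pos ⟨σ, hj⟩
  have hB0 := pos_of_two_rpow_neg_lt_rho hB
  obtain ⟨N, hN⟩ := hS.exists_horizon x
  have hlaw : ∀ v, μ.real {ω | S.badPrefix x (fun k => X k ω) = v} =
      S.pathExp σ₁ N (fun s => if S.badPrefix x s = v then 1 else 0) := fun v => by
    rw [hX.measureReal_eq (S.dependsOn_badPrefix hN) v]
    congr!
  have hprob : S.pathExp σ₁ N (fun _ => 1) = 1 := by
    -- A constant G makes the event the whole space, so the path probabilities sum to 1.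
    have h := hX.measureReal_eq (G := fun _ => ()) (n := N) (fun _ _ _ => rfl) ()
    simpa using h.symm
  -- A finite set L carrying the law of the bad prefix turns the entropy series into a finite sum.
  -- From a flawless start the bad prefix is always empty and the entropy is 0.
  obtain ⟨L, hL, hle⟩ : ∃ L : Finset (List Ω), (∀ s : ℕ → Ω, s 0 = σ₁ → S.badPrefix x s ∈ L) ∧
      ((∑ v ∈ L, S.pathExp σ₁ N (fun s => if S.badPrefix x s = v then 1 else 0) = 1) →
        ∑ v ∈ L, entropyTerm (S.pathExp σ₁ N (fun s => if S.badPrefix x s = v then 1 else 0)) ≤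
          Real.logb 2 (Fintype.card Ω * 2 ^ m) + lam * (x + B)) := by
    by_cases hσ₁ : S.Flawed σ₁
    · refine ⟨walks N σ₁, fun s h0 => h0 ▸ S.badPrefix_mem_walks hN (h0 ▸ hσ₁), fun h => ?_⟩
      exact hS.sum_entropyTerm_walks_le hlam0 hB (by linarith) hσ₁ hN hprob h
    · refine ⟨{[]}, fun s h0 => ?_, fun h => ?_⟩
      · rw [badPrefix, S.badLength_eq_zero (h0 ▸ hσ₁)]
        simp
      · rw [Finset.sum_singleton] at h ⊢
        rw [h]
        have h1 : (1 : ℝ) ≤ Fintype.card Ω * 2 ^ m := by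
          exact_mod_cast Nat.mul_pos Fintype.card_pos (by positivity)
        have h2 := Real.logb_nonneg one_lt_two h1
        have h3 : 0 ≤ lam * (x + B) := by positivity
        simp only [entropyTerm, Real.logb_one, mul_zero, neg_zero]
        linarith
  have hzero : ∀ v ∉ L,
      entropyTerm (μ.real {ω | S.badPrefix x (fun k => X k ω) = v}) = 0 := by
    intro v hv
    have h0 : S.pathExp σ₁ N (fun s => if S.badPrefix x s = v then 1 else 0) = 0 := by
      refine Finset.sum_eq_zero fun t _ => ?_
      rw [startProb]
      split_ifs with h1
      · have h2 : S.badPrefix x (extendPath t) ≠ v := fun h2 => hv (h2 ▸ hL _ h1)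
        simp only [if_neg h2, mul_zero]
      · exact zero_mul _
    rw [hlaw, h0]
    simp [entropyTerm]
  have hsum : ∑ v ∈ L, S.pathExp σ₁ N (fun s => if S.badPrefix x s = v then 1 else 0) = 1 := by
    rw [← pathExp_sum]
    refine Eq.trans ?_ hprob
    refine Finset.sum_congr rfl fun t _ => ?_
    rw [startProb]
    split_ifs with h0
    · simp only [Finset.sum_ite_eq, if_pos (hL _ h0)]
    · rw [zero_mul, zero_mul]
  refine ⟨summable_of_ne_finset_zero hzero, ?_⟩
  rw [entropyBits, tsum_eq_sum hzero]
  simp only [hlaw]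
  have hK := logb_card_mul_two_pow_le (S := S) (lam := lam) (B := B)
  have := hle hsum
  linarith
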